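/- Let $M$ be a closed oriented $4$-manifold, $B$ a closed manifold, and $\pi:\mathcal X\to B$ an oriented fibre bundle with fibre $M$, i.e. the fibres $\mathcal X_b=\pi^{-1}(b)$ are oriented and $\pi$ is locally trivial through trivializations that preserve the orientations of the fibres. Let $p=b^+(M)$ be the maximal dimension of a subspace of $H^2(M;\mathbb R)$ on which the intersection form $x\mapsto\langle x\cup x,[M]\rangle$ is positive definite. Let $\mathcal V\to B$ be the flat vector bundle with fibres $\mathcal V_b=H^2(\mathcal X_b;\mathbb R)$, and let $\mathcal P\to B$ be the period bundle, i.e. the subspace of $Gr_p(\mathcal V)\times_B\mathcal V$ whose fibre over $b$ consists of the pairs $(W,l)$ of a $p$-dimensional subspace $W\subset H^2(\mathcal X_b;\mathbb R)$ on which the intersection form of $\mathcal X_b$ is positive definite and a class $l\in H^2(\mathcal X_b;\mathbb R)$ that is not perpendicular to $W$. Then there is a fibre bundle $S\to B$ with fibre the sphere $S^{p-1}$ (where $S^{-1}=\emptyset$) such that $\mathcal P\to B$ and $S\to B$ are fibrewise homotopy equivalent: there are continuous maps $\mathcal P\to S$ and $S\to\mathcal P$ over $B$ whose two compositions are homotopic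 to the identity maps through maps over $B$. -/

import Mathlib

open CategoryTheory Opposite

universe u v

namespace FamilySW

section SingularTheory

variable (X : Type u) [TopologicalSpace X]

/-- Singular `n`-simplices of `X`, i.e. continuous maps from the standard `n`-simplex to `X`. -/
abbrev Simplex (n : ℕ) : Type u :=
  (TopCat.toSSet.obj (TopCat.of X)).obj (op (SimplexCategory.mk n))

variable {X}

/-- The simplex `σ ∘ f_*`, for a monotone map `f : {0, …, k} → {0, …, n}` of vertices. -/
noncomputable def Simplex.sub {k n : ℕ} (f : SimplexCategory.mk k ⟶ SimplexCategory.mk n)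
    (σ : Simplex X n) : Simplex X k :=
  (TopCat.toSSet.obj (TopCat.of X)).map f.op σ

/-- The simplex `f ∘ σ` of `Y`, for `σ` a simplex of `X` and a continuous map `f : X → Y`. -/
noncomputable def Simplex.push {Y : Type u} [TopologicalSpace Y] (f : C(X, Y)) {n : ℕ} (σ : Simplex X n) :
    Simplex Y n :=
  (TopCat.toSSet.map (TopCat.ofHom f)).app _ σ

theorem Simplex.sub_sub {k l n : ℕ} (f : SimplexCategory.mk k ⟶ SimplexCategory.mk l)
    (g : SimplexCategory.mk l ⟶ SimplexCategory.mk n) (σ : Simplex X n) :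
    (σ.sub g).sub f = σ.sub (f ≫ g) := by
  simp [Simplex.sub]

theorem Simplex.push_sub {Y : Type u} [TopologicalSpace Y] (F : C(X, Y)) {k n : ℕ}
    (f : SimplexCategory.mk k ⟶ SimplexCategory.mk n) (σ : Simplex X n) :
    (σ.sub f).push F = (σ.push F).sub f := by
  exact NatTrans.naturality_apply (TopCat.toSSet.map (TopCat.ofHom F)) f.op σ

theorem Simplex.push_id {n : ℕ} (σ : Simplex X n) : σ.push (ContinuousMap.id X) = σ := by
  have h : TopCat.ofHom (ContinuousMap.id X) = 𝟙 (TopCat.of X) := rfl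
  simp [Simplex.push, h]

theorem Simplex.push_comp {Y Z : Type u} [TopologicalSpace Y] [TopologicalSpace Z]
    (f : C(X, Y)) (g : C(Y, Z)) {n : ℕ} (σ : Simplex X n) :
    σ.push (g.comp f) = (σ.push f).push g := by
  simp [Simplex.push, TopCat.ofHom_comp]

variable (X)

/-! ### Singular homology with integer coefficients -/

/-- Singular `n`-chains with integer coefficients. -/
abbrev Chain (n : ℕ) : Type u := Simplex X n →₀ ℤ

/-- The boundary operator `∂ σ = ∑ (-1)^i dᵢ σ`. -/
noncomputable def boundary (n : ℕ) : Chain X (n + 1) →ₗ[ℤ] Chain X n :=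
  Finsupp.linearCombination ℤ fun σ : Simplex X (n + 1) =>
    ∑ i : Fin (n + 2), Finsupp.single (σ.sub (SimplexCategory.δ i)) ((-1 : ℤ) ^ (i : ℕ))

/-- Cycles; in degree `0` every chain is a cycle. -/
noncomputable def cycles : ∀ n : ℕ, Submodule ℤ (Chain X n)
  | 0 => ⊤
  | n + 1 => LinearMap.ker (boundary X n)

noncomputable def boundaries (n : ℕ) : Submodule ℤ (Chain X n) :=
  LinearMap.range (boundary X n)

/-- The singular homology group `H_n(X; ℤ)`. -/
abbrev Homology (n : ℕ) : Type u :=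
  cycles X n ⧸ (boundaries X n).submoduleOf (cycles X n)

/-! ### Singular cohomology with real coefficients -/

/-- Singular `n`-cochains with real coefficients. -/
abbrev Cochain (n : ℕ) : Type u := Simplex X n → ℝ

/-- The coboundary operator `(δ φ) σ = ∑ (-1)^i φ (dᵢ σ)`. -/
noncomputable def coboundary (n : ℕ) : Cochain X n →ₗ[ℝ] Cochain X (n + 1) where
  toFun φ σ := ∑ i : Fin (n + 2), (-1 : ℝ) ^ (i : ℕ) * φ (σ.sub (SimplexCategory.δ i))
  map_add' φ ψ := by
    funext σ
    simp [mul_add, Finset.sum_add_distrib]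
  map_smul' r φ := by
    funext σ
    simp only [Pi.smul_apply, smul_eq_mul, RingHom.id_apply, Finset.mul_sum]
    exact Finset.sum_congr rfl fun i _ => by ring

noncomputable def cocycles (n : ℕ) : Submodule ℝ (Cochain X n) :=
  LinearMap.ker (coboundary X n)

/-- Coboundaries; in degree `0` only the zero cochain is a coboundary. -/
noncomputable def coboundaries : ∀ n : ℕ, Submodule ℝ (Cochain X n)
  | 0 => ⊥
  | n + 1 => LinearMap.range (coboundary X n)

/-- The singular cohomology `H^n(X; ℝ)`, a real vector space. -/
def Cohomology (n : ℕ) : Type u :=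
  cocycles X n ⧸ (coboundaries X n).submoduleOf (cocycles X n)

noncomputable instance (n : ℕ) : AddCommGroup (Cohomology X n) :=
  inferInstanceAs (AddCommGroup (cocycles X n ⧸ (coboundaries X n).submoduleOf (cocycles X n)))

noncomputable instance (n : ℕ) : Module ℝ (Cohomology X n) :=
  inferInstanceAs (Module ℝ (cocycles X n ⧸ (coboundaries X n).submoduleOf (cocycles X n)))

/-- The finest topology that makes the vector space operations continuous. On a finite
dimensional real vector space this is the usual topology. -/
noncomputable instance (n : ℕ) : TopologicalSpace (Cohomology X n) :=
  moduleTopology ℝ (Cohomology X n)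

instance (n : ℕ) : IsModuleTopology ℝ (Cohomology X n) := ⟨rfl⟩

/-- The cohomology class of a cocycle. -/
noncomputable def Cohomology.mk (n : ℕ) : cocycles X n →ₗ[ℝ] Cohomology X n :=
  ((coboundaries X n).submoduleOf (cocycles X n)).mkQ

variable {X}

/-! ### Induced maps -/

noncomputable def Chain.push {Y : Type u} [TopologicalSpace Y] (f : C(X, Y)) (n : ℕ) :
    Chain X n →ₗ[ℤ] Chain Y n :=
  Finsupp.lmapDomain ℤ ℤ (Simplex.push f)

theorem Chain.push_boundary {Y : Type u} [TopologicalSpace Y] (f : C(X, Y)) (n : ℕ)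
    (c : Chain X (n + 1)) :
    Chain.push f n (boundary X n c) = boundary Y n (Chain.push f (n + 1) c) := by
  have h : (Chain.push f n).comp (boundary X n) =
      (boundary Y n).comp (Chain.push f (n + 1)) := by
    ext σ : 2
    simp [Chain.push, boundary, Finsupp.mapDomain_single,
      Simplex.push_sub]
  exact LinearMap.congr_fun h c

theorem Chain.push_mem_cycles {Y : Type u} [TopologicalSpace Y] (f : C(X, Y)) (n : ℕ) :
    cycles X n ≤ (cycles Y n).comap (Chain.push f n) := by
  intro c hc
  cases n with
  | zero => exact Submodule.mem_top
  | succ n =>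
    have hc' : boundary X n c = 0 := hc
    change boundary Y n (Chain.push f (n + 1) c) = 0
    rw [← Chain.push_boundary, hc', map_zero]

/-- The map `f_* : H_n(X; ℤ) → H_n(Y; ℤ)` induced by a continuous map `f : X → Y`. -/
noncomputable def Homology.push {Y : Type u} [TopologicalSpace Y] (f : C(X, Y)) (n : ℕ) :
    Homology X n →ₗ[ℤ] Homology Y n :=
  Submodule.mapQ _ _ ((Chain.push f n).restrict (Chain.push_mem_cycles f n)) (by
    rintro ⟨c, hc⟩ ⟨d, hd⟩
    exact ⟨Chain.push f (n + 1) d, by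
      rw [← Chain.push_boundary, hd]
      rfl⟩)

noncomputable def Cochain.pull {Y : Type u} [TopologicalSpace Y] (f : C(X, Y)) (n : ℕ) :
    Cochain Y n →ₗ[ℝ] Cochain X n :=
  LinearMap.funLeft ℝ ℝ (Simplex.push f)

theorem Cochain.pull_coboundary {Y : Type u} [TopologicalSpace Y] (f : C(X, Y)) (n : ℕ)
    (φ : Cochain Y n) :
    Cochain.pull f (n + 1) (coboundary Y n φ) = coboundary X n (Cochain.pull f n φ) := by
  funext σ
  simp [Cochain.pull, coboundary, LinearMap.funLeft_apply, Simplex.push_sub]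

theorem Cochain.pull_mem_cocycles {Y : Type u} [TopologicalSpace Y] (f : C(X, Y)) (n : ℕ) :
    cocycles Y n ≤ (cocycles X n).comap (Cochain.pull f n) := by
  intro φ hφ
  have hφ' : coboundary Y n φ = 0 := hφ
  change coboundary X n (Cochain.pull f n φ) = 0
  rw [← Cochain.pull_coboundary, hφ', map_zero]

/-- The map `f^* : H^n(Y; ℝ) → H^n(X; ℝ)` induced by a continuous map `f : X → Y`. -/
noncomputable def Cohomology.pull {Y : Type u} [TopologicalSpace Y] (f : C(X, Y)) (n : ℕ) :
    Cohomology Y n →ₗ[ℝ] Cohomology X n :=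
  Submodule.mapQ _ _ ((Cochain.pull f n).restrict (Cochain.pull_mem_cocycles f n)) (by
    rintro ⟨φ, hφ⟩ h
    cases n with
    | zero =>
      have h0 : φ = 0 := h
      subst h0
      exact map_zero (Cochain.pull f 0)
    | succ n =>
      obtain ⟨ψ, hψ⟩ := h
      exact ⟨Cochain.pull f n ψ, by
        rw [← Cochain.pull_coboundary, hψ]
        rfl⟩)

theorem Cohomology.pull_id (n : ℕ) (x : Cohomology X n) :
    Cohomology.pull (ContinuousMap.id X) n x = x := by
  obtain ⟨φ, rfl⟩ := Submodule.mkQ_surjective _ x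
  refine congrArg (Cohomology.mk X n) (Subtype.ext ?_)
  funext σ
  exact congrArg φ.1 (Simplex.push_id σ)

theorem Cohomology.pull_comp {Y Z : Type u} [TopologicalSpace Y] [TopologicalSpace Z]
    (f : C(X, Y)) (g : C(Y, Z)) (n : ℕ) (x : Cohomology Z n) :
    Cohomology.pull (g.comp f) n x = Cohomology.pull f n (Cohomology.pull g n x) := by
  obtain ⟨φ, rfl⟩ := Submodule.mkQ_surjective _ x
  refine congrArg (Cohomology.mk X n) (Subtype.ext ?_)
  funext σ
  exact congrArg φ.1 (Simplex.push_comp f g σ)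

/-- The isomorphism `h^* : H^n(Y; ℝ) ≃ H^n(X; ℝ)` induced by a homeomorphism `h : X ≃ Y`. -/
noncomputable def Cohomology.pullEquiv {Y : Type u} [TopologicalSpace Y] (h : X ≃ₜ Y) (n : ℕ) :
    Cohomology Y n ≃ₗ[ℝ] Cohomology X n :=
  { Cohomology.pull (h : C(X, Y)) n with
    invFun := Cohomology.pull (h.symm : C(Y, X)) n
    left_inv := fun x => by
      change Cohomology.pull _ n (Cohomology.pull _ n x) = x
      rw [← Cohomology.pull_comp, Homeomorph.toContinuousMap_comp_symm, Cohomology.pull_id]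
    right_inv := fun x => by
      change Cohomology.pull _ n (Cohomology.pull _ n x) = x
      rw [← Cohomology.pull_comp, Homeomorph.symm_comp_toContinuousMap, Cohomology.pull_id] }

/-! ### Evaluation of cohomology classes on homology classes -/

/-- The pairing `⟨φ, ∑ k_σ σ⟩ = ∑ k_σ φ(σ)` of cochains with chains. -/
noncomputable def evalChain (n : ℕ) : Chain X n →ₗ[ℤ] (Cochain X n →ₗ[ℝ] ℝ) :=
  Finsupp.linearCombination ℤ fun σ : Simplex X n => LinearMap.proj σ

theorem evalChain_boundary (n : ℕ) (c : Chain X (n + 1)) (φ : Cochain X n) :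
    evalChain n (boundary X n c) φ = evalChain (n + 1) c (coboundary X n φ) := by
  induction c using Finsupp.induction_linear with
  | zero => simp
  | add c d hc hd => simp [hc, hd]
  | single σ k =>
    simp [evalChain, boundary, coboundary, LinearMap.sum_apply]

theorem evalChain_eq_zero_of_coboundary (n : ℕ) {c : Chain X n} (hc : c ∈ cycles X n)
    {φ : Cochain X n} (hφ : φ ∈ coboundaries X n) : evalChain n c φ = 0 := by
  cases n with
  | zero =>
    have h0 : φ = 0 := hφ
    rw [h0, map_zero]
  | succ n =>
    obtain ⟨ψ, rfl⟩ := hφ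
    have hc' : boundary X n c = 0 := hc
    rw [← evalChain_boundary, hc', map_zero, LinearMap.zero_apply]

theorem evalChain_eq_zero_of_boundary (n : ℕ) {c : Chain X n} (hc : c ∈ boundaries X n)
    {φ : Cochain X n} (hφ : φ ∈ cocycles X n) : evalChain n c φ = 0 := by
  obtain ⟨d, rfl⟩ := hc
  have hφ' : coboundary X n φ = 0 := hφ
  rw [evalChain_boundary, hφ', map_zero]

/-- Evaluation of a cohomology class on a cycle. -/
noncomputable def evalCycle (n : ℕ) : cycles X n →ₗ[ℤ] (Cohomology X n →ₗ[ℝ] ℝ) where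
  toFun c := Submodule.liftQ _ ((evalChain n c.1).comp (cocycles X n).subtype)
    (fun _ hφ => evalChain_eq_zero_of_coboundary n c.2 hφ)
  map_add' c d := by
    apply LinearMap.ext
    intro x
    obtain ⟨φ, rfl⟩ := Submodule.mkQ_surjective _ x
    change evalChain n (c.1 + d.1) φ.1 = evalChain n c.1 φ.1 + evalChain n d.1 φ.1
    rw [map_add, LinearMap.add_apply]
  map_smul' k c := by
    apply LinearMap.ext
    intro x
    obtain ⟨φ, rfl⟩ := Submodule.mkQ_surjective _ x
    change evalChain n (k • c.1) φ.1 = k • evalChain n c.1 φ.1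
    rw [map_smul, LinearMap.smul_apply]

/-- The Kronecker pairing `H_n(X; ℤ) × H^n(X; ℝ) → ℝ`. -/
noncomputable def kronecker (n : ℕ) : Homology X n →ₗ[ℤ] (Cohomology X n →ₗ[ℝ] ℝ) :=
  Submodule.liftQ _ (evalCycle n) (by
    rintro c hc
    apply LinearMap.ext
    intro x
    obtain ⟨φ, rfl⟩ := Submodule.mkQ_surjective _ x
    exact evalChain_eq_zero_of_boundary n hc φ.2)

/-! ### The cup product `H² × H² → H⁴` -/

/-- The cup product of cochains,
`(φ ∪ ψ)(σ) = φ(σ|[v₀, …, v_p]) ψ(σ|[v_p, …, v_{p+q}])`. -/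
noncomputable def cupCochain {p q n : ℕ} (h : p + q = n) :
    Cochain X p →ₗ[ℝ] Cochain X q →ₗ[ℝ] Cochain X n :=
  LinearMap.mk₂ ℝ
    (fun φ ψ σ =>
      φ (σ.sub (SimplexCategory.subinterval 0 p (by omega))) *
        ψ (σ.sub (SimplexCategory.subinterval p q h.le)))
    (fun φ φ' ψ => by funext σ; simp [add_mul])
    (fun r φ ψ => by funext σ; simp [mul_assoc])
    (fun φ ψ ψ' => by funext σ; simp [mul_add])
    (fun r φ ψ => by funext σ; simp [mul_left_comm])

theorem coboundary_one (φ : Cochain X 1) (σ : Simplex X 2) :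
    coboundary X 1 φ σ = φ (σ.sub (SimplexCategory.δ 0)) - φ (σ.sub (SimplexCategory.δ 1)) + 
      φ (σ.sub (SimplexCategory.δ 2)) := by
  refine (Fin.sum_univ_three
    fun i : Fin 3 => (-1 : ℝ) ^ (i : ℕ) * φ (σ.sub (SimplexCategory.δ i))).trans ?_
  norm_num [Fin.val_ofNat]
  ring

theorem coboundary_two (φ : Cochain X 2) (σ : Simplex X 3) :
    coboundary X 2 φ σ = φ (σ.sub (SimplexCategory.δ 0)) - φ (σ.sub (SimplexCategory.δ 1)) + 
      φ (σ.sub (SimplexCategory.δ 2)) - φ (σ.sub (SimplexCategory.δ 3)) := by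
  refine (Fin.sum_univ_four
    fun i : Fin 4 => (-1 : ℝ) ^ (i : ℕ) * φ (σ.sub (SimplexCategory.δ i))).trans ?_
  norm_num [Fin.val_ofNat]
  ring

theorem coboundary_three (φ : Cochain X 3) (σ : Simplex X 4) :
    coboundary X 3 φ σ = φ (σ.sub (SimplexCategory.δ 0)) - φ (σ.sub (SimplexCategory.δ 1)) + 
      φ (σ.sub (SimplexCategory.δ 2)) - φ (σ.sub (SimplexCategory.δ 3)) + 
      φ (σ.sub (SimplexCategory.δ 4)) := by
  refine (Fin.sum_univ_five
    fun i : Fin 5 => (-1 : ℝ) ^ (i : ℕ) * φ (σ.sub (SimplexCategory.δ i))).trans ?_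
  norm_num [Fin.val_ofNat]
  ring

theorem coboundary_four (φ : Cochain X 4) (σ : Simplex X 5) :
    coboundary X 4 φ σ = φ (σ.sub (SimplexCategory.δ 0)) - φ (σ.sub (SimplexCategory.δ 1)) + 
      φ (σ.sub (SimplexCategory.δ 2)) - φ (σ.sub (SimplexCategory.δ 3)) + 
      φ (σ.sub (SimplexCategory.δ 4)) - φ (σ.sub (SimplexCategory.δ 5)) := by
  refine (Fin.sum_univ_six
    fun i : Fin 6 => (-1 : ℝ) ^ (i : ℕ) * φ (σ.sub (SimplexCategory.δ i))).trans ?_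
  norm_num [Fin.val_ofNat]
  ring

theorem cupCochain_apply {p q n : ℕ} (h : p + q = n) (φ : Cochain X p) (ψ : Cochain X q)
    (σ : Simplex X n) :
    cupCochain h φ ψ σ = φ (σ.sub (SimplexCategory.subinterval 0 p (by omega))) *
      ψ (σ.sub (SimplexCategory.subinterval p q h.le)) := rfl

theorem coboundary_cup_one_two (φ : Cochain X 1) (ψ : Cochain X 2) :
    coboundary X 3 (cupCochain (p := 1) (q := 2) rfl φ ψ) =
      cupCochain (p := 2) (q := 2) rfl (coboundary X 1 φ) ψ -
        cupCochain (p := 1) (q := 3) rfl φ (coboundary X 2 ψ) := by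
  funext σ
  have e0 : (SimplexCategory.subinterval (n := 3) 1 2 (by omega)) ≫ (SimplexCategory.δ (n := 3) 0) =
      (SimplexCategory.subinterval (n := 4) 2 2 (by omega)) := by
    ext i; fin_cases i <;> rfl
  have e1 : (SimplexCategory.subinterval (n := 3) 1 2 (by omega)) ≫ (SimplexCategory.δ (n := 3) 1) =
      (SimplexCategory.subinterval (n := 4) 2 2 (by omega)) := by
    ext i; fin_cases i <;> rfl
  have e2 : (SimplexCategory.subinterval (n := 3) 0 1 (by omega)) ≫ (SimplexCategory.δ (n := 3) 2) =
      (SimplexCategory.subinterval (n := 4) 0 1 (by omega)) := by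
    ext i; fin_cases i <;> rfl
  have e3 : (SimplexCategory.subinterval (n := 3) 0 1 (by omega)) ≫ (SimplexCategory.δ (n := 3) 3) =
      (SimplexCategory.subinterval (n := 4) 0 1 (by omega)) := by
    ext i; fin_cases i <;> rfl
  have e4 : (SimplexCategory.subinterval (n := 3) 0 1 (by omega)) ≫ (SimplexCategory.δ (n := 3) 4) =
      (SimplexCategory.subinterval (n := 4) 0 1 (by omega)) := by
    ext i; fin_cases i <;> rfl
  have e5 : (SimplexCategory.δ (n := 1) 0) ≫ (SimplexCategory.subinterval (n := 4) 0 2 (by omega)) =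
      (SimplexCategory.subinterval (n := 3) 0 1 (by omega)) ≫ (SimplexCategory.δ (n := 3) 0) := by
    ext i; fin_cases i <;> rfl
  have e6 : (SimplexCategory.δ (n := 1) 1) ≫ (SimplexCategory.subinterval (n := 4) 0 2 (by omega)) =
      (SimplexCategory.subinterval (n := 3) 0 1 (by omega)) ≫ (SimplexCategory.δ (n := 3) 1) := by
    ext i; fin_cases i <;> rfl
  have e7 : (SimplexCategory.δ (n := 1) 2) ≫ (SimplexCategory.subinterval (n := 4) 0 2 (by omega)) =
      (SimplexCategory.subinterval (n := 4) 0 1 (by omega)) := by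
    ext i; fin_cases i <;> rfl
  have e8 : (SimplexCategory.δ (n := 2) 0) ≫ (SimplexCategory.subinterval (n := 4) 1 3 (by omega)) =
      (SimplexCategory.subinterval (n := 4) 2 2 (by omega)) := by
    ext i; fin_cases i <;> rfl
  have e9 : (SimplexCategory.δ (n := 2) 1) ≫ (SimplexCategory.subinterval (n := 4) 1 3 (by omega)) =
      (SimplexCategory.subinterval (n := 3) 1 2 (by omega)) ≫ (SimplexCategory.δ (n := 3) 2) := by
    ext i; fin_cases i <;> rfl
  have e10 : (SimplexCategory.δ (n := 2) 2) ≫ (SimplexCategory.subinterval (n := 4) 1 3 (by omega)) =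
      (SimplexCategory.subinterval (n := 3) 1 2 (by omega)) ≫ (SimplexCategory.δ (n := 3) 3) := by
    ext i; fin_cases i <;> rfl
  have e11 : (SimplexCategory.δ (n := 2) 3) ≫ (SimplexCategory.subinterval (n := 4) 1 3 (by omega)) =
      (SimplexCategory.subinterval (n := 3) 1 2 (by omega)) ≫ (SimplexCategory.δ (n := 3) 4) := by
    ext i; fin_cases i <;> rfl
  rw [coboundary_three, Pi.sub_apply]
  simp only [cupCochain_apply, coboundary_one, coboundary_two, Simplex.sub_sub]
  simp only [Fin.isValue, e0, e1, e2, e3, e4, e5, e6, e7, e8, e9, e10, e11]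
  ring

theorem coboundary_cup_two_one (φ : Cochain X 2) (ψ : Cochain X 1) :
    coboundary X 3 (cupCochain (p := 2) (q := 1) rfl φ ψ) =
      cupCochain (p := 3) (q := 1) rfl (coboundary X 2 φ) ψ +
        cupCochain (p := 2) (q := 2) rfl φ (coboundary X 1 ψ) := by
  funext σ
  have e0 : (SimplexCategory.subinterval (n := 3) 2 1 (by omega)) ≫ (SimplexCategory.δ (n := 3) 0) =
      (SimplexCategory.subinterval (n := 4) 3 1 (by omega)) := by
    ext i; fin_cases i <;> rfl
  have e1 : (SimplexCategory.subinterval (n := 3) 2 1 (by omega)) ≫ (SimplexCategory.δ (n := 3) 1) =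
      (SimplexCategory.subinterval (n := 4) 3 1 (by omega)) := by
    ext i; fin_cases i <;> rfl
  have e2 : (SimplexCategory.subinterval (n := 3) 2 1 (by omega)) ≫ (SimplexCategory.δ (n := 3) 2) =
      (SimplexCategory.subinterval (n := 4) 3 1 (by omega)) := by
    ext i; fin_cases i <;> rfl
  have e3 : (SimplexCategory.subinterval (n := 3) 0 2 (by omega)) ≫ (SimplexCategory.δ (n := 3) 3) =
      (SimplexCategory.subinterval (n := 4) 0 2 (by omega)) := by
    ext i; fin_cases i <;> rfl
  have e4 : (SimplexCategory.subinterval (n := 3) 0 2 (by omega)) ≫ (SimplexCategory.δ (n := 3) 4) =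
      (SimplexCategory.subinterval (n := 4) 0 2 (by omega)) := by
    ext i; fin_cases i <;> rfl
  have e5 : (SimplexCategory.δ (n := 2) 0) ≫ (SimplexCategory.subinterval (n := 4) 0 3 (by omega)) =
      (SimplexCategory.subinterval (n := 3) 0 2 (by omega)) ≫ (SimplexCategory.δ (n := 3) 0) := by
    ext i; fin_cases i <;> rfl
  have e6 : (SimplexCategory.δ (n := 2) 1) ≫ (SimplexCategory.subinterval (n := 4) 0 3 (by omega)) =
      (SimplexCategory.subinterval (n := 3) 0 2 (by omega)) ≫ (SimplexCategory.δ (n := 3) 1) := by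
    ext i; fin_cases i <;> rfl
  have e7 : (SimplexCategory.δ (n := 2) 2) ≫ (SimplexCategory.subinterval (n := 4) 0 3 (by omega)) =
      (SimplexCategory.subinterval (n := 3) 0 2 (by omega)) ≫ (SimplexCategory.δ (n := 3) 2) := by
    ext i; fin_cases i <;> rfl
  have e8 : (SimplexCategory.δ (n := 2) 3) ≫ (SimplexCategory.subinterval (n := 4) 0 3 (by omega)) =
      (SimplexCategory.subinterval (n := 4) 0 2 (by omega)) := by
    ext i; fin_cases i <;> rfl
  have e9 : (SimplexCategory.δ (n := 1) 0) ≫ (SimplexCategory.subinterval (n := 4) 2 2 (by omega)) =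
      (SimplexCategory.subinterval (n := 4) 3 1 (by omega)) := by
    ext i; fin_cases i <;> rfl
  have e10 : (SimplexCategory.δ (n := 1) 1) ≫ (SimplexCategory.subinterval (n := 4) 2 2 (by omega)) =
      (SimplexCategory.subinterval (n := 3) 2 1 (by omega)) ≫ (SimplexCategory.δ (n := 3) 3) := by
    ext i; fin_cases i <;> rfl
  have e11 : (SimplexCategory.δ (n := 1) 2) ≫ (SimplexCategory.subinterval (n := 4) 2 2 (by omega)) =
      (SimplexCategory.subinterval (n := 3) 2 1 (by omega)) ≫ (SimplexCategory.δ (n := 3) 4) := by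
    ext i; fin_cases i <;> rfl
  rw [coboundary_three, Pi.add_apply]
  simp only [cupCochain_apply, coboundary_one, coboundary_two, Simplex.sub_sub]
  simp only [Fin.isValue, e0, e1, e2, e3, e4, e5, e6, e7, e8, e9, e10, e11]
  ring

theorem coboundary_cup_two_two (φ : Cochain X 2) (ψ : Cochain X 2) :
    coboundary X 4 (cupCochain (p := 2) (q := 2) rfl φ ψ) =
      cupCochain (p := 3) (q := 2) rfl (coboundary X 2 φ) ψ +
        cupCochain (p := 2) (q := 3) rfl φ (coboundary X 2 ψ) := by
  funext σ
  have e0 : (SimplexCategory.subinterval (n := 4) 2 2 (by omega)) ≫ (SimplexCategory.δ (n := 4) 0) =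
      (SimplexCategory.subinterval (n := 5) 3 2 (by omega)) := by
    ext i; fin_cases i <;> rfl
  have e1 : (SimplexCategory.subinterval (n := 4) 2 2 (by omega)) ≫ (SimplexCategory.δ (n := 4) 1) =
      (SimplexCategory.subinterval (n := 5) 3 2 (by omega)) := by
    ext i; fin_cases i <;> rfl
  have e2 : (SimplexCategory.subinterval (n := 4) 2 2 (by omega)) ≫ (SimplexCategory.δ (n := 4) 2) =
      (SimplexCategory.subinterval (n := 5) 3 2 (by omega)) := by
    ext i; fin_cases i <;> rfl
  have e3 : (SimplexCategory.subinterval (n := 4) 0 2 (by omega)) ≫ (SimplexCategory.δ (n := 4) 3) =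
      (SimplexCategory.subinterval (n := 5) 0 2 (by omega)) := by
    ext i; fin_cases i <;> rfl
  have e4 : (SimplexCategory.subinterval (n := 4) 0 2 (by omega)) ≫ (SimplexCategory.δ (n := 4) 4) =
      (SimplexCategory.subinterval (n := 5) 0 2 (by omega)) := by
    ext i; fin_cases i <;> rfl
  have e5 : (SimplexCategory.subinterval (n := 4) 0 2 (by omega)) ≫ (SimplexCategory.δ (n := 4) 5) =
      (SimplexCategory.subinterval (n := 5) 0 2 (by omega)) := by
    ext i; fin_cases i <;> rfl
  have e6 : (SimplexCategory.δ (n := 2) 0) ≫ (SimplexCategory.subinterval (n := 5) 0 3 (by omega)) =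
      (SimplexCategory.subinterval (n := 4) 0 2 (by omega)) ≫ (SimplexCategory.δ (n := 4) 0) := by
    ext i; fin_cases i <;> rfl
  have e7 : (SimplexCategory.δ (n := 2) 1) ≫ (SimplexCategory.subinterval (n := 5) 0 3 (by omega)) =
      (SimplexCategory.subinterval (n := 4) 0 2 (by omega)) ≫ (SimplexCategory.δ (n := 4) 1) := by
    ext i; fin_cases i <;> rfl
  have e8 : (SimplexCategory.δ (n := 2) 2) ≫ (SimplexCategory.subinterval (n := 5) 0 3 (by omega)) =
      (SimplexCategory.subinterval (n := 4) 0 2 (by omega)) ≫ (SimplexCategory.δ (n := 4) 2) := by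
    ext i; fin_cases i <;> rfl
  have e9 : (SimplexCategory.δ (n := 2) 3) ≫ (SimplexCategory.subinterval (n := 5) 0 3 (by omega)) =
      (SimplexCategory.subinterval (n := 5) 0 2 (by omega)) := by
    ext i; fin_cases i <;> rfl
  have e10 : (SimplexCategory.δ (n := 2) 0) ≫ (SimplexCategory.subinterval (n := 5) 2 3 (by omega)) =
      (SimplexCategory.subinterval (n := 5) 3 2 (by omega)) := by
    ext i; fin_cases i <;> rfl
  have e11 : (SimplexCategory.δ (n := 2) 1) ≫ (SimplexCategory.subinterval (n := 5) 2 3 (by omega)) =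
      (SimplexCategory.subinterval (n := 4) 2 2 (by omega)) ≫ (SimplexCategory.δ (n := 4) 3) := by
    ext i; fin_cases i <;> rfl
  have e12 : (SimplexCategory.δ (n := 2) 2) ≫ (SimplexCategory.subinterval (n := 5) 2 3 (by omega)) =
      (SimplexCategory.subinterval (n := 4) 2 2 (by omega)) ≫ (SimplexCategory.δ (n := 4) 4) := by
    ext i; fin_cases i <;> rfl
  have e13 : (SimplexCategory.δ (n := 2) 3) ≫ (SimplexCategory.subinterval (n := 5) 2 3 (by omega)) =
      (SimplexCategory.subinterval (n := 4) 2 2 (by omega)) ≫ (SimplexCategory.δ (n := 4) 5) := by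
    ext i; fin_cases i <;> rfl
  rw [coboundary_four, Pi.add_apply]
  simp only [cupCochain_apply, coboundary_two, Simplex.sub_sub]
  simp only [Fin.isValue, e0, e1, e2, e3, e4, e5, e6, e7, e8, e9, e10, e11, e12, e13]
  ring

theorem cup_mem_cocycles (φ ψ : cocycles X 2) :
    cupCochain (p := 2) (q := 2) rfl φ.1 ψ.1 ∈ cocycles X 4 := by
  have hφ : coboundary X 2 φ.1 = 0 := φ.2
  have hψ : coboundary X 2 ψ.1 = 0 := ψ.2
  refine LinearMap.mem_ker.2 ?_
  rw [coboundary_cup_two_two, hφ, hψ, map_zero, map_zero, LinearMap.zero_apply, add_zero]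

/-- The cup product of two cocycles of degree `2`, as a cocycle. -/
noncomputable def cupCocycle : cocycles X 2 →ₗ[ℝ] cocycles X 2 →ₗ[ℝ] cocycles X 4 :=
  LinearMap.mk₂ ℝ (fun φ ψ => ⟨cupCochain (p := 2) (q := 2) rfl φ.1 ψ.1, cup_mem_cocycles φ ψ⟩)
    (fun φ φ' ψ => Subtype.ext (LinearMap.map_add₂ (cupCochain rfl) φ.1 φ'.1 ψ.1))
    (fun r φ ψ => Subtype.ext (LinearMap.map_smul₂ (cupCochain rfl) r φ.1 ψ.1))
    (fun φ ψ ψ' => Subtype.ext (map_add (cupCochain rfl φ.1) ψ.1 ψ'.1))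
    (fun r φ ψ => Subtype.ext (map_smul (cupCochain rfl φ.1) r ψ.1))

theorem cupCocycle_eq_zero_left (φ ψ : cocycles X 2) (h : φ.1 ∈ coboundaries X 2) :
    Cohomology.mk X 4 (cupCocycle φ ψ) = 0 := by
  obtain ⟨χ, hχ⟩ := h
  have hψ : coboundary X 2 ψ.1 = 0 := ψ.2
  refine (Submodule.Quotient.mk_eq_zero _).2 ⟨cupCochain (p := 1) (q := 2) rfl χ ψ.1, ?_⟩
  rw [coboundary_cup_one_two, hψ, map_zero, sub_zero, hχ]
  rfl

theorem cupCocycle_eq_zero_right (φ ψ : cocycles X 2) (h : ψ.1 ∈ coboundaries X 2) :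
    Cohomology.mk X 4 (cupCocycle φ ψ) = 0 := by
  obtain ⟨χ, hχ⟩ := h
  have hφ : coboundary X 2 φ.1 = 0 := φ.2
  refine (Submodule.Quotient.mk_eq_zero _).2 ⟨cupCochain (p := 2) (q := 1) rfl φ.1 χ, ?_⟩
  rw [coboundary_cup_two_one, hφ, map_zero, LinearMap.zero_apply, zero_add, hχ]
  rfl

/-- The cup product `H²(X; ℝ) × H²(X; ℝ) → H⁴(X; ℝ)`. -/
noncomputable def cup : Cohomology X 2 →ₗ[ℝ] Cohomology X 2 →ₗ[ℝ] Cohomology X 4 :=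
  Submodule.liftQ _
    (LinearMap.flip (Submodule.liftQ _ (LinearMap.flip (cupCocycle.compr₂ (Cohomology.mk X 4))) (by
      intro ψ hψ
      exact LinearMap.ext fun φ => cupCocycle_eq_zero_right φ ψ hψ)))
    (by
      intro φ hφ
      apply LinearMap.ext
      intro y
      obtain ⟨ψ, rfl⟩ := Submodule.mkQ_surjective _ y
      exact cupCocycle_eq_zero_left φ ψ hφ)

/-- The quadratic form `x ↦ ⟨x ∪ x, z⟩` on `H²(X; ℝ)`, for `z ∈ H₄(X; ℤ)`. When `X` is a closed
oriented `4`-manifold and `z` is its fundamental class, it is the intersection form of `X`. -/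
noncomputable def intersectionForm (z : Homology X 4) : QuadraticForm ℝ (Cohomology X 2) :=
  LinearMap.BilinMap.toQuadraticMap
    ((cup (X := X)).compr₂ (kronecker 4 z))

/-- The chains of `X` that lie in the complement of the point `x`. -/
noncomputable def chainsAvoiding (x : X) (n : ℕ) : Submodule ℤ (Chain X n) :=
  LinearMap.range
    (Chain.push (⟨Subtype.val, continuous_subtype_val⟩ : C(({x}ᶜ : Set X), X)) n)

/-- `z ∈ H_{n+1}(X; ℤ)` is a fundamental class of `X`, i.e. at every point `x` it restricts to a
generator of the local homology group `H_{n+1}(X, X ∖ {x}; ℤ)`: some cycle `c` that represents `z`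
is such that every relative cycle `a` is homologous to an integer multiple `k c`, relative to
`X ∖ {x}`. An orientation of a closed manifold of dimension `n + 1` is the same thing as a
fundamental class. -/
def IsFundamentalClass {n : ℕ} (z : Homology X (n + 1)) : Prop :=
  ∃ c : cycles X (n + 1), Submodule.Quotient.mk c = z ∧
    ∀ (x : X) (a : Chain X (n + 1)), boundary X n a ∈ chainsAvoiding x n →
      ∃ (k : ℤ) (d : Chain X (n + 2)),
        a - k • c.1 - boundary X (n + 1) d ∈ chainsAvoiding x (n + 1)

end SingularTheory

section PeriodSpace

variable (p : ℕ) (V : Type u) [AddCommGroup V] [Module ℝ V]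

/-- The Grassmannian of `p`-dimensional subspaces of `V`. -/
def Gr : Type u :=
  {W : Submodule ℝ V // FiniteDimensional ℝ W ∧ Module.finrank ℝ W = p}

variable {p V}

/-- The subspace spanned by a linearly independent `p`-frame. -/
noncomputable def Gr.span (v : {v : Fin p → V // LinearIndependent ℝ v}) : Gr p V :=
  ⟨Submodule.span ℝ (Set.range v.1), FiniteDimensional.span_of_finite ℝ (Set.finite_range v.1),
    by rw [finrank_span_eq_card v.2, Fintype.card_fin]⟩

/-- The Grassmannian carries the quotient topology from the space of `p`-frames. -/
noncomputable instance [TopologicalSpace V] : TopologicalSpace (Gr p V) :=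
  TopologicalSpace.coinduced Gr.span inferInstance

/-- The image of a subspace under a linear isomorphism. -/
def Gr.map {V' : Type u} [AddCommGroup V'] [Module ℝ V'] (e : V ≃ₗ[ℝ] V') (W : Gr p V) :
    Gr p V' :=
  ⟨W.1.map e.toLinearMap, have := W.2.1; inferInstance,
    by rw [LinearEquiv.finrank_map_eq, W.2.2]⟩

/-- The period space of a quadratic space `(V, Q)`: the pairs `(W, l)` of a positive definite
`p`-plane `W` in `V` and a vector `l` of `V` that is not perpendicular to `W`. -/
def periodSpace (p : ℕ) (Q : QuadraticForm ℝ V) : Set (Gr p V × V) :=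
  {x | (Q.restrict x.1.1).PosDef ∧ ∃ w ∈ x.1.1, ¬ Q.IsOrtho x.2 w}

end PeriodSpace

section Bundles

/-- `π : E → B` is a (locally trivial) fibre bundle with fibre `F`. -/
def IsFibreBundle (F : Type*) {E B : Type*} [TopologicalSpace F] [TopologicalSpace E]
    [TopologicalSpace B] (π : E → B) : Prop :=
  ∀ b : B, ∃ e : Bundle.Trivialization F π, b ∈ e.baseSet

/-- `π₁ : E₁ → B` and `π₂ : E₂ → B` are fibrewise homotopy equivalent: there are maps over `B`
in both directions, whose two compositions are homotopic to the identity through maps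
over `B`. -/
def FibrewiseHomotopyEquivalent {E₁ E₂ B : Type*} [TopologicalSpace E₁] [TopologicalSpace E₂]
    (π₁ : E₁ → B) (π₂ : E₂ → B) : Prop :=
  ∃ (f : C(E₁, E₂)) (g : C(E₂, E₁)), (∀ x, π₂ (f x) = π₁ x) ∧ (∀ y, π₁ (g y) = π₂ y) ∧
    (g.comp f).HomotopicWith (ContinuousMap.id E₁) (fun h => ∀ x, π₁ (h x) = π₁ x) ∧
    (f.comp g).HomotopicWith (ContinuousMap.id E₂) (fun h => ∀ y, π₂ (h y) = π₂ y)

variable (M : Type u) {X : Type u} {B : Type v} [TopologicalSpace M] [TopologicalSpace X]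
  [TopologicalSpace B] (π : X → B)

/-- A family `o` of orientation classes of the fibres of `π` makes `π` an oriented fibre bundle
with fibre `(M, μ)`: near every point of the base there is a local trivialization that is
orientation preserving on every fibre. -/
def IsOrientedFibreBundle (μ : Homology M 4) (o : ∀ b : B, Homology (π ⁻¹' {b}) 4) : Prop :=
  ∀ b₀ : B, ∃ e : Bundle.Trivialization M π, b₀ ∈ e.baseSet ∧
    ∀ (b : B) (hb : b ∈ e.baseSet),
      Homology.push (e.preimageSingletonHomeomorph hb : C(π ⁻¹' {b}, M)) 4 (o b) = μ

/-- The bundle `Gr_p(𝒱) ×_B 𝒱` over `B`, where `𝒱` is the flat bundle with fibre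
`H²(X_b; ℝ)` over `b`. (The space `M` is recorded for the topology below.) -/
@[nolint unusedArguments]
def GrBundle (_M : Type u) [TopologicalSpace _M] (π : X → B) (p : ℕ) : Type (max u v) :=
  Σ b : B, Gr p (Cohomology (π ⁻¹' {b}) 2) × Cohomology (π ⁻¹' {b}) 2

variable {M π} in
/-- The flat chart `U × (Gr_p(V) × V) → Gr_p(𝒱) ×_B 𝒱`, with `V = H²(M; ℝ)`, given by a local
trivialization `π⁻¹(U) ≃ U × M`. Over `b` it is induced by the isomorphism
`H²(M; ℝ) ≃ H²(X_b; ℝ)`. -/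
noncomputable def GrBundle.chart (p : ℕ) (e : Bundle.Trivialization M π)
    (x : e.baseSet × (Gr p (Cohomology M 2) × Cohomology M 2)) : GrBundle M π p :=
  ⟨x.1.1,
    Gr.map (Cohomology.pullEquiv (e.preimageSingletonHomeomorph x.1.2) 2) x.2.1,
    Cohomology.pullEquiv (e.preimageSingletonHomeomorph x.1.2) 2 x.2.2⟩

/-- `Gr_p(𝒱) ×_B 𝒱` is glued from its flat charts: it carries the finest topology for which all
of them are continuous. -/
noncomputable instance (p : ℕ) : TopologicalSpace (GrBundle M π p) :=
  ⨆ e : Bundle.Trivialization M π, TopologicalSpace.coinduced (GrBundle.chart p e) inferInstance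

/-- The (total space of the) period bundle, a subspace of `Gr_p(𝒱) ×_B 𝒱`: its fibre over `b` is
the period space of `H²(X_b; ℝ)` with its intersection form. -/
def PeriodBundle (p : ℕ) (o : ∀ b : B, Homology (π ⁻¹' {b}) 4) : Type (max u v) :=
  {x : GrBundle M π p // x.2 ∈ periodSpace p (intersectionForm (o x.1))}

instance (p : ℕ) (o : ∀ b : B, Homology (π ⁻¹' {b}) 4) :
    TopologicalSpace (PeriodBundle M π p o) :=
  inferInstanceAs (TopologicalSpace
    {x : GrBundle M π p // x.2 ∈ periodSpace p (intersectionForm (o x.1))})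

/-- The projection of the period bundle to `B`. -/
def PeriodBundle.proj (p : ℕ) (o : ∀ b : B, Homology (π ⁻¹' {b}) 4) :
    PeriodBundle M π p o → B :=
  fun x => x.1.1

end Bundles

end FamilySW

/-!
Write `V = H²(M; ℝ)` with its intersection form `Q`, and `p = b⁺(M)`. If `p = 0`, both the period
bundle and the sphere `S^{p-1}` are empty. If `p > 0`, then `V` has finite dimension, so that `Q` is
continuous, and the proof is as follows.

**The fibre.** For a positive definite `p`-plane `W` let `P_W` be the orthogonal projection to `W`.
By maximality of `p`, `Q` is negative semidefinite on the orthogonal complement of `W`, and so the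
linear map `slide Q W t = t + (1 - t) P_W`, for `t ∈ [0, 1]`, does not decrease `Q`
(`le_apply_slide`). Hence it maps positive definite `p`-planes to positive definite `p`-planes; at
`t = 1` it is the identity, at `t = 0` it maps all of them onto `W`. A pair `(W', l)` lies in the
period space exactly if `P_{W'} l ≠ 0`. Moving `l` to `P_{W'} l` (`straighten`), and then `W'` and
this vector to `W` (`slideTo`), deforms the period space to the unit sphere of `W`. All of this is
natural under isometries.

**A global positive plane.** The bundle `𝒱` is flat (`FlatAtlas`), since homotopic maps induce the
same map on `H²` and the base is locally path connected (`eventually_pullEquiv_eq`); for the same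
reason the flat charts of the bundle `Gr_p(𝒱) ×_B 𝒱` are open embeddings. In each of finitely many
oriented flat charts that cover `B` choose the plane that is constantly `W`, and a cutoff function
`f` with support in the chart, such that at each point some cutoff function is `1`. The composition
of the maps `slide Q W (1 - f)`, each extended by the identity, is a global endomorphism of `𝒱`. At
every point it maps all positive definite `p`-planes to the same plane `P b`, because one of its
factors does. This is a continuous family of positive definite `p`-planes
(`FlatAtlas.exists_posPlane`).

**Conclusion.** `S` is the bundle of unit spheres of the planes `P b`. It is a subspace of the
period bundle, which by `straighten` and `slideTo` retracts to it by deformation over `B`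
(`FlatAtlas.fibrewiseHomotopyEquivalent`), and it is locally trivial by means of coordinates in
continuous frames of `P b` (`FlatAtlas.isFibreBundle_sphere`).
-/

namespace FamilySW

/-! ### Homotopy invariance of `H²` -/

/-- The chain homotopy is the prism operator `τ ↦ h₀ τ - h₁ τ` on `1`-simplices, where the `hᵢ`
are the operators of the simplicial homotopy between the maps of singular sets. -/
theorem Cohomology.pull_two_eq_of_simplicialHomotopy {X Y : Type u} [TopologicalSpace X]
    [TopologicalSpace Y] {f g : C(X, Y)}
    (h : SimplicialObject.Homotopy (TopCat.toSSet.map (TopCat.ofHom f))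
      (TopCat.toSSet.map (TopCat.ofHom g))) :
    Cohomology.pull f 2 = Cohomology.pull g 2 := by
  -- The prism operators are made opaque; the proof uses only the faces of their values.
  obtain ⟨K, hK⟩ : ∃ K : ∀ {n : ℕ}, Fin (n + 1) → Simplex X n → Simplex Y (n + 1),
    ∀ {n : ℕ} (i : Fin (n + 1)) (τ : Simplex X n), K i τ = h.h i τ :=
    ⟨fun i τ => h.h i τ, fun _ _ => rfl⟩
  have r0 (τ : Simplex X 2) : (K 0 τ).sub (SimplexCategory.δ 0) = τ.push g := by
    simp only [hK]
    exact ConcreteCategory.congr_hom (h.h_zero_comp_δ_zero 2) τ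
  have r1 (τ : Simplex X 2) : (K 2 τ).sub (SimplexCategory.δ 3) = τ.push f := by
    simp only [hK]
    exact ConcreteCategory.congr_hom (h.h_last_comp_δ_last 2) τ
  have r2 (τ : Simplex X 2) : (K 1 τ).sub (SimplexCategory.δ 0) =
      K 0 (τ.sub (SimplexCategory.δ 0)) := by
    simp only [hK]
    exact ConcreteCategory.congr_hom (h.h_succ_comp_δ_castSucc_of_lt (n := 1) 0 0 (by decide)) τ
  have r3 (τ : Simplex X 2) : (K 2 τ).sub (SimplexCategory.δ 0) =
      K 1 (τ.sub (SimplexCategory.δ 0)) := by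
    simp only [hK]
    exact ConcreteCategory.congr_hom (h.h_succ_comp_δ_castSucc_of_lt (n := 1) 0 1 (by decide)) τ
  have r4 (τ : Simplex X 2) : (K 2 τ).sub (SimplexCategory.δ 1) =
      K 1 (τ.sub (SimplexCategory.δ 1)) := by
    simp only [hK]
    exact ConcreteCategory.congr_hom (h.h_succ_comp_δ_castSucc_of_lt (n := 1) 1 1 (by decide)) τ
  have r5 (τ : Simplex X 2) : (K 1 τ).sub (SimplexCategory.δ 1) =
      (K 0 τ).sub (SimplexCategory.δ 1) := by
    simp only [hK]
    exact ConcreteCategory.congr_hom (h.h_succ_comp_δ_castSucc_succ (n := 1) 0) τ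
  have r6 (τ : Simplex X 2) : (K 2 τ).sub (SimplexCategory.δ 2) =
      (K 1 τ).sub (SimplexCategory.δ 2) := by
    simp only [hK]
    exact ConcreteCategory.congr_hom (h.h_succ_comp_δ_castSucc_succ (n := 1) 1) τ
  have r7 (τ : Simplex X 2) : (K 0 τ).sub (SimplexCategory.δ 2) =
      K 0 (τ.sub (SimplexCategory.δ 1)) := by
    simp only [hK]
    exact ConcreteCategory.congr_hom (h.h_castSucc_comp_δ_succ_of_lt (n := 1) 1 0 (by decide)) τ
  have r8 (τ : Simplex X 2) : (K 0 τ).sub (SimplexCategory.δ 3) =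
      K 0 (τ.sub (SimplexCategory.δ 2)) := by
    simp only [hK]
    exact ConcreteCategory.congr_hom (h.h_castSucc_comp_δ_succ_of_lt (n := 1) 2 0 (by decide)) τ
  have r9 (τ : Simplex X 2) : (K 1 τ).sub (SimplexCategory.δ 3) =
      K 1 (τ.sub (SimplexCategory.δ 2)) := by
    simp only [hK]
    exact ConcreteCategory.congr_hom (h.h_castSucc_comp_δ_succ_of_lt (n := 1) 2 1 (by decide)) τ
  apply LinearMap.ext
  intro x
  obtain ⟨φ, rfl⟩ := Submodule.mkQ_surjective _ x
  refine (Submodule.Quotient.eq _).2 ?_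
  refine ⟨fun τ => φ.1 (K 1 τ) - φ.1 (K 0 τ), ?_⟩
  funext τ
  have c (i : Fin 3) : coboundary Y 2 φ.1 (K i τ) = 0 := by
    have : coboundary Y 2 φ.1 = 0 := φ.2
    rw [this]; rfl
  have c0 := c 0
  have c1 := c 1
  have c2 := c 2
  rw [coboundary_two] at c0 c1 c2
  rw [coboundary_one]
  change _ = φ.1 (τ.push f) - φ.1 (τ.push g)
  simp only [r0, r1, r2, r3, r4, r5, r6, r7, r8, r9] at c0 c1 c2
  linarith

theorem Cohomology.pull_two_eq_of_homotopic {X Y : Type u} [TopologicalSpace X]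
    [TopologicalSpace Y] {f g : C(X, Y)} (H : f.Homotopic g) :
    Cohomology.pull f 2 = Cohomology.pull g 2 := by
  obtain ⟨H⟩ := H
  have H' : TopCat.Homotopy (TopCat.ofHom f) (TopCat.ofHom g) := H
  exact Cohomology.pull_two_eq_of_simplicialHomotopy H'.toSSet.toSimplicialObjectHomotopy

/-! ### Orthogonal projections to positive definite subspaces -/

section QuadraticSpace

open QuadraticMap

variable {V : Type u} [AddCommGroup V] [Module ℝ V] {p : ℕ} {Q : QuadraticForm ℝ V}

theorem two_mul_apply_eq_polar (Q : QuadraticForm ℝ V) (x : V) : polar Q x x = 2 * Q x := by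
  rw [polar_self, two_nsmul, two_mul]

theorem apply_add_smul_of_polar_eq_zero {x y : V} (h : polar Q x y = 0) (t : ℝ) :
    Q (x + t • y) = Q x + t ^ 2 * Q y := by
  have h1 : polar Q x (t • y) = 0 := by rw [polar_smul_right, h, smul_zero]
  have h2 : Q (x + t • y) = Q x + Q (t • y) + polar Q x (t • y) := QuadraticMap.map_add Q x (t • y)
  rw [h2, h1, QuadraticMap.map_smul, smul_eq_mul]
  ring

theorem pos_of_mem {W : Submodule ℝ V} (hW : (Q.restrict W).PosDef) {x : V} (hx : x ∈ W)
    (h0 : x ≠ 0) : 0 < Q x :=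
  hW ⟨x, hx⟩ fun h => h0 (congrArg Subtype.val h)

/-- The Gram matrix of a family of vectors, with respect to the polar form of `Q`. -/
def gramMatrix (Q : QuadraticForm ℝ V) (v : Fin p → V) : Matrix (Fin p) (Fin p) ℝ :=
  Matrix.of fun i j => polar Q (v i) (v j)

theorem gramMatrix_mulVec (Q : QuadraticForm ℝ V) (v : Fin p → V) (c : Fin p → ℝ) (i : Fin p) :
    (gramMatrix Q v).mulVec c i = polar Q (v i) (∑ j, c j • v j) := by
  change _ = Q.polarBilin (v i) (∑ j, c j • v j)
  simp [Matrix.mulVec, dotProduct, gramMatrix, mul_comm]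

/-- A vector in the kernel of the Gram matrix consists of the coordinates of an isotropic vector. -/
theorem isUnit_det_gramMatrix {v : Fin p → V} (hv : LinearIndependent ℝ v)
    (hQ : (Q.restrict (Submodule.span ℝ (Set.range v))).PosDef) :
    IsUnit (gramMatrix Q v).det := by
  rw [isUnit_iff_ne_zero]
  intro h
  obtain ⟨c, hc, h0⟩ := Matrix.exists_mulVec_eq_zero_iff.2 h
  have hmem : ∑ j, c j • v j ∈ Submodule.span ℝ (Set.range v) :=
    Submodule.sum_mem _ fun j _ => Submodule.smul_mem _ _ (Submodule.subset_span ⟨j, rfl⟩)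
  have hz : Q.polarBilin (∑ i, c i • v i) (∑ j, c j • v j) = 0 := by
    rw [map_sum Q.polarBilin, LinearMap.sum_apply]
    refine Finset.sum_eq_zero fun i _ => ?_
    have := gramMatrix_mulVec Q v c i
    rw [h0] at this
    rw [map_smul, LinearMap.smul_apply, polarBilin_apply_apply, ← this]
    simp
  rw [polarBilin_apply_apply, two_mul_apply_eq_polar] at hz
  have hx : ∑ j, c j • v j = 0 := by
    by_contra hne
    have := pos_of_mem hQ hmem hne
    linarith
  exact hc (funext fun i => Fintype.linearIndependent_iff.1 hv c hx i)

/-- The coordinates, in the frame `v`, of the orthogonal projection of a vector to the span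
of `v`. -/
noncomputable def frameCoord (Q : QuadraticForm ℝ V) (v : Fin p → V) : V →ₗ[ℝ] Fin p → ℝ :=
  (gramMatrix Q v)⁻¹.mulVecLin ∘ₗ LinearMap.pi fun i => Q.polarBilin (v i)

theorem frameCoord_apply (v : Fin p → V) (x : V) :
    frameCoord Q v x = (gramMatrix Q v)⁻¹.mulVec fun i => polar Q (v i) x := rfl

theorem frameCoord_sum {v : Fin p → V} (hv : LinearIndependent ℝ v)
    (hQ : (Q.restrict (Submodule.span ℝ (Set.range v))).PosDef) (c : Fin p → ℝ) :
    frameCoord Q v (∑ j, c j • v j) = c := by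
  have h : (fun i => polar Q (v i) (∑ j, c j • v j)) = (gramMatrix Q v).mulVec c :=
    funext fun i => (gramMatrix_mulVec Q v c i).symm
  rw [frameCoord_apply, h, Matrix.mulVec_mulVec,
    Matrix.nonsing_inv_mul _ (isUnit_det_gramMatrix hv hQ), Matrix.one_mulVec]

/-- The orthogonal projection to the span of the frame `v`. -/
noncomputable def frameProj (Q : QuadraticForm ℝ V) (v : Fin p → V) : V →ₗ[ℝ] V :=
  Fintype.linearCombination ℝ v ∘ₗ frameCoord Q v

theorem frameProj_apply (v : Fin p → V) (x : V) :
    frameProj Q v x = ∑ j, frameCoord Q v x j • v j := rfl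

theorem frameProj_mem (v : Fin p → V) (x : V) :
    frameProj Q v x ∈ Submodule.span ℝ (Set.range v) :=
  frameProj_apply (Q := Q) v x ▸
    Submodule.sum_mem _ fun j _ => Submodule.smul_mem _ _ (Submodule.subset_span ⟨j, rfl⟩)

theorem polar_sub_frameProj {v : Fin p → V} (hv : LinearIndependent ℝ v)
    (hQ : (Q.restrict (Submodule.span ℝ (Set.range v))).PosDef) (x : V) {w : V}
    (hw : w ∈ Submodule.span ℝ (Set.range v)) : polar Q (x - frameProj Q v x) w = 0 := by
  suffices h : Submodule.span ℝ (Set.range v) ≤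
      LinearMap.ker (Q.polarBilin (x - frameProj Q v x)) from h hw
  rw [Submodule.span_le]
  rintro _ ⟨i, rfl⟩
  change polar Q (x - frameProj Q v x) (v i) = 0
  have h := gramMatrix_mulVec Q v (frameCoord Q v x) i
  rw [frameCoord_apply, Matrix.mulVec_mulVec,
    Matrix.mul_nonsing_inv _ (isUnit_det_gramMatrix hv hQ), Matrix.one_mulVec] at h
  rw [polar_sub_left, frameProj_apply, polar_comm, h, frameCoord_apply, polar_comm, sub_self]

theorem Gr.span_surjective : Function.Surjective
    (Gr.span : {v : Fin p → V // LinearIndependent ℝ v} → Gr p V) := by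
  intro W
  have := W.2.1
  let b := Module.finBasisOfFinrankEq ℝ W.1 W.2.2
  have hb : LinearIndependent ℝ fun i => (b i : V) :=
    b.linearIndependent.map' W.1.subtype W.1.ker_subtype
  refine ⟨⟨_, hb⟩, Subtype.ext ?_⟩
  change Submodule.span ℝ (Set.range (W.1.subtype ∘ b)) = W.1
  rw [Set.range_comp, Submodule.span_image, b.span_eq, Submodule.map_subtype_top]

/-- The orthogonal projection of `V` to `W`. It is meaningful when `Q` is positive definite
on `W`; the definition uses a frame of `W`, but the projection does not depend on it. -/
noncomputable def posProj (Q : QuadraticForm ℝ V) (W : Gr p V) : V →ₗ[ℝ] V :=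
  frameProj Q (Gr.span_surjective W).choose.1

theorem posProj_mem (W : Gr p V) (x : V) : posProj Q W x ∈ W.1 := by
  have h := (Gr.span_surjective W).choose_spec
  have := frameProj_mem (Q := Q) (Gr.span_surjective W).choose.1 x
  exact (congrArg Subtype.val h) ▸ this

theorem polar_sub_posProj {W : Gr p V} (hW : (Q.restrict W.1).PosDef) (x : V) {w : V}
    (hw : w ∈ W.1) : polar Q (x - posProj Q W x) w = 0 := by
  have h : Submodule.span ℝ (Set.range (Gr.span_surjective W).choose.1) = W.1 :=
    congrArg Subtype.val (Gr.span_surjective W).choose_spec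
  exact polar_sub_frameProj (Gr.span_surjective W).choose.2 (h.symm ▸ hW) x (h.symm ▸ hw)

theorem posProj_eq_of_polar {W : Gr p V} (hW : (Q.restrict W.1).PosDef) {x y : V} (hy : y ∈ W.1)
    (h : ∀ w ∈ W.1, polar Q (x - y) w = 0) : posProj Q W x = y := by
  have hm : posProj Q W x - y ∈ W.1 := W.1.sub_mem (posProj_mem W x) hy
  by_contra hne
  have h1 := pos_of_mem hW hm (sub_ne_zero.2 hne)
  have h2 := polar_sub_posProj hW x hm
  have h3 := h _ hm
  have h4 : polar Q (posProj Q W x - y) (posProj Q W x - y) = 0 := by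
    have e : posProj Q W x - y = (x - y) - (x - posProj Q W x) := by abel
    calc _ = polar Q ((x - y) - (x - posProj Q W x)) (posProj Q W x - y) := by rw [← e]
      _ = 0 := by rw [polar_sub_left, h3, h2, sub_zero]
  rw [two_mul_apply_eq_polar] at h4
  linarith

theorem posProj_of_mem {W : Gr p V} (hW : (Q.restrict W.1).PosDef) {x : V} (hx : x ∈ W.1) :
    posProj Q W x = x :=
  posProj_eq_of_polar hW hx fun w _ => by rw [sub_self, polar_zero_left]

theorem posProj_span (v : {v : Fin p → V // LinearIndependent ℝ v})
    (hv : (Q.restrict (Gr.span v).1).PosDef) : posProj Q (Gr.span v) = frameProj Q v.1 :=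
  LinearMap.ext fun x => posProj_eq_of_polar hv (frameProj_mem _ _) fun _ hw =>
    polar_sub_frameProj v.2 hv x hw

/-- The vectors that are not perpendicular to `W` are those with nonzero projection to `W`. -/
theorem mem_periodSpace_iff {x : Gr p V × V} :
    x ∈ periodSpace p Q ↔ (Q.restrict x.1.1).PosDef ∧ posProj Q x.1 x.2 ≠ 0 := by
  refine and_congr_right fun hW => ?_
  have key (w : V) (hw : w ∈ x.1.1) : polar Q x.2 w = polar Q (posProj Q x.1 x.2) w := by
    have := polar_sub_posProj hW x.2 hw
    rw [polar_sub_left] at this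
    linarith
  constructor
  · rintro ⟨w, hw, h⟩ h0
    refine h (isOrtho_polarBilin.1 ?_)
    rw [polarBilin_apply_apply, key w hw, h0, polar_zero_left]
  · intro h0
    refine ⟨posProj Q x.1 x.2, posProj_mem x.1 x.2, fun h => ?_⟩
    have h1 := pos_of_mem hW (posProj_mem x.1 x.2) h0
    have h2 := h.polar_eq_zero
    rw [key _ (posProj_mem _ _), two_mul_apply_eq_polar] at h2
    linarith

/-! ### Sliding one positive subspace to another -/

variable (p Q) in
/-- No positive definite `p`-plane of `(V, Q)` can be enlarged: on its orthogonal complement, `Q` is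
negative semidefinite. This holds if `p` is the positive index of `Q`, by `posIndexLE_sigPos`. -/
def PosIndexLE : Prop :=
  ∀ W : Gr p V, (Q.restrict W.1).PosDef → ∀ x : V, (∀ w ∈ W.1, polar Q x w = 0) → Q x ≤ 0

theorem posIndexLE_sigPos [Module.Finite ℝ V] : PosIndexLE (sigPos Q) Q := by
  intro W hW x hx
  by_contra! hpos
  have hxW : x ∉ W.1 := fun h => by
    have := hx x h
    rw [two_mul_apply_eq_polar] at this
    linarith
  have hPD : (Q.restrict (W.1 ⊔ ℝ ∙ x)).PosDef := by
    rintro ⟨z, hz⟩ hz0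
    obtain ⟨w, hw, y, hy, rfl⟩ := Submodule.mem_sup.1 hz
    obtain ⟨t, rfl⟩ := Submodule.mem_span_singleton.1 hy
    change 0 < Q (w + t • x)
    rw [apply_add_smul_of_polar_eq_zero ((polar_comm Q w x).trans (hx w hw))]
    by_cases hw0 : w = 0
    · subst hw0
      have ht : t ≠ 0 := by
        rintro rfl
        exact hz0 (Subtype.ext (by simp))
      rw [QuadraticMap.map_zero, zero_add]
      positivity
    · have := pos_of_mem hW hw hw0
      positivity
  have h1 := le_sigPos_of_posDef Q hPD
  have h2 : Module.finrank ℝ W.1 < Module.finrank ℝ (W.1 ⊔ ℝ ∙ x : Submodule ℝ V) :=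
    Submodule.finrank_lt_finrank_of_lt (lt_of_le_of_ne le_sup_left fun h => hxW (by
      rw [h]
      exact Submodule.mem_sup_right (Submodule.mem_span_singleton_self x)))
  rw [W.2.2] at h2
  omega

/-- The linear map `t + (1 - t) P`, where `P` is the orthogonal projection to `W`. It interpolates
between the projection to `W`, at `t = 0`, and the identity, at `t = 1`. -/
noncomputable def slide (Q : QuadraticForm ℝ V) (W : Gr p V) (t : ℝ) : V →ₗ[ℝ] V :=
  t • LinearMap.id + (1 - t) • posProj Q W

theorem slide_apply (W : Gr p V) (t : ℝ) (x : V) :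
    slide Q W t x = t • x + (1 - t) • posProj Q W x := rfl

theorem slide_zero (W : Gr p V) : slide Q W 0 = posProj Q W := by simp [slide]

theorem slide_one (W : Gr p V) : slide Q W 1 = LinearMap.id := by simp [slide]

/-- If `x = y + z` with `y ∈ W` and `z ⊥ W`, then `Q z ≤ 0`, and sliding replaces `z` by `t z`. -/
theorem le_apply_slide (hp : PosIndexLE p Q) {W : Gr p V} (hW : (Q.restrict W.1).PosDef) {t : ℝ}
    (ht : t ∈ Set.Icc (0 : ℝ) 1) (x : V) : Q x ≤ Q (slide Q W t x) := by
  set y := posProj Q W x with hy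
  have hz (w : V) (hw : w ∈ W.1) : polar Q (x - y) w = 0 := polar_sub_posProj hW x hw
  have hyz : polar Q y (x - y) = 0 := (polar_comm Q _ _).trans (hz y (posProj_mem W x))
  have hneg := hp W hW (x - y) hz
  have e1 : slide Q W t x = y + t • (x - y) := by
    rw [slide_apply, ← hy]
    module
  have e2 : x = y + (1 : ℝ) • (x - y) := by module
  have h2 := apply_add_smul_of_polar_eq_zero hyz 1
  rw [← e2] at h2
  rw [e1, apply_add_smul_of_polar_eq_zero hyz, h2]
  have : t ^ 2 ≤ 1 := by nlinarith [ht.1, ht.2]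
  nlinarith

variable (p Q) in
/-- The space of positive definite `p`-planes of `(V, Q)`. -/
abbrev PosGr : Type u := {W : Gr p V // (Q.restrict W.1).PosDef}

/-- The image of a positive definite `p`-plane under a linear map that does not decrease `Q`. -/
def PosGr.push (T : V →ₗ[ℝ] V) (hT : ∀ x, Q x ≤ Q (T x)) (W : PosGr p Q) : PosGr p Q := by
  have hpos (x : V) (hx : x ∈ W.1.1) (h0 : x ≠ 0) : 0 < Q (T x) :=
    (pos_of_mem W.2 hx h0).trans_le (hT x)
  refine ⟨⟨W.1.1.map T, ?_, ?_⟩, ?_⟩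
  · have := W.1.2.1
    infer_instance
  · have hinj : Function.Injective (T.domRestrict W.1.1) := by
      rw [← LinearMap.ker_eq_bot, LinearMap.ker_eq_bot']
      intro x hx
      by_contra h0
      have h1 := hpos x.1 x.2 fun h => h0 (Subtype.ext h)
      have hx' : T x.1 = 0 := hx
      rw [hx', QuadraticMap.map_zero] at h1
      exact lt_irrefl _ h1
    have h2 := LinearMap.finrank_range_of_inj hinj
    rw [LinearMap.range_domRestrict, W.1.2.2] at h2
    exact h2
  · rintro ⟨_, x, hx, rfl⟩ h0
    exact hpos x hx fun h => h0 (Subtype.ext (by simp [h]))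

theorem PosGr.apply_mem_push {T : V →ₗ[ℝ] V} {hT : ∀ x, Q x ≤ Q (T x)} {W : PosGr p Q} {x : V}
    (hx : x ∈ W.1.1) : T x ∈ (W.push T hT).1.1 := ⟨x, hx, rfl⟩

theorem Gr.eq_of_le {W W' : Gr p V} (h : W.1 ≤ W'.1) : W = W' := by
  have := W'.2.1
  exact Subtype.ext (Submodule.eq_of_le_of_finrank_eq h (W.2.2.trans W'.2.2.symm))

theorem PosGr.push_eq_of_mem {T : V →ₗ[ℝ] V} {hT : ∀ x, Q x ≤ Q (T x)} {W W' : PosGr p Q}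
    (h : ∀ x ∈ W.1.1, T x ∈ W'.1.1) : W.push T hT = W' := by
  refine Subtype.ext (Gr.eq_of_le ?_)
  rintro _ ⟨x, hx, rfl⟩
  exact h x hx

theorem slide_zero_push (W W' : PosGr p Q) (h : ∀ x, Q x ≤ Q (slide Q W.1 0 x)) :
    W'.push (slide Q W.1 0) h = W :=
  PosGr.push_eq_of_mem fun x _ => by
    rw [slide_zero]
    exact posProj_mem _ _

theorem PosGr.push_span (T : V →ₗ[ℝ] V) (hT : ∀ x, Q x ≤ Q (T x)) (W : PosGr p Q)
    (v : {v : Fin p → V // LinearIndependent ℝ v}) (hv : Gr.span v = W.1) :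
    ∃ h : LinearIndependent ℝ fun i => T (v.1 i), (W.push T hT).1 = Gr.span ⟨_, h⟩ := by
  have hW : Submodule.span ℝ (Set.range v.1) = W.1.1 := congrArg Subtype.val hv
  have hli : LinearIndependent ℝ fun i => T (v.1 i) := by
    refine v.2.map_injOn T ?_
    rw [hW]
    intro x hx y hy hxy
    by_contra hne
    have h1 := (pos_of_mem W.2 (W.1.1.sub_mem hx hy) (sub_ne_zero.2 hne)).trans_le (hT _)
    rw [map_sub, hxy, sub_self, QuadraticMap.map_zero] at h1
    exact lt_irrefl _ h1
  refine ⟨hli, Subtype.ext ?_⟩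
  change W.1.1.map T = Submodule.span ℝ (Set.range (T ∘ v.1))
  rw [Set.range_comp, Submodule.span_image, hW]

/-! ### Deformations of the period space -/

/-- Move `l` along a segment to its orthogonal projection to `W`, which is reached at `s = 1`. -/
noncomputable def straighten (s : ℝ) (x : periodSpace p Q) : periodSpace p Q :=
  ⟨(x.1.1, x.1.2 + s • (posProj Q x.1.1 x.1.2 - x.1.2)), by
    have hx := mem_periodSpace_iff.1 x.2
    refine mem_periodSpace_iff.2 ⟨hx.1, ?_⟩
    change posProj Q x.1.1 (x.1.2 + s • (posProj Q x.1.1 x.1.2 - x.1.2)) ≠ 0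
    rw [map_add, map_smul, map_sub, posProj_of_mem hx.1 (posProj_mem _ _), sub_self, smul_zero,
      add_zero]
    exact hx.2⟩

/-- The positive definite plane of a point of the period space. -/
def posPlane (x : periodSpace p Q) : PosGr p Q := ⟨x.1.1, x.2.1⟩

/-- The factor that makes the end point, at `t = 0`, of the deformation `slideTo` a unit vector. -/
noncomputable def slideFactor (W : PosGr p Q) (t : ℝ) (x : periodSpace p Q) : ℝ :=
  t + (1 - t) * (√(Q (posProj Q W.1 (posProj Q x.1.1 x.1.2))))⁻¹

theorem apply_slide_pos (hp : PosIndexLE p Q) (W : PosGr p Q) {t : ℝ} (ht : t ∈ Set.Icc (0 : ℝ) 1)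
    (x : periodSpace p Q) : 0 < Q (slide Q W.1 t (posProj Q x.1.1 x.1.2)) :=
  have hx := mem_periodSpace_iff.1 x.2
  (pos_of_mem hx.1 (posProj_mem _ _) hx.2).trans_le (le_apply_slide hp W.2 ht _)

theorem apply_posProj_pos (hp : PosIndexLE p Q) (W : PosGr p Q)
    (x : periodSpace p Q) : 0 < Q (posProj Q W.1 (posProj Q x.1.1 x.1.2)) := by
  have := apply_slide_pos hp W ⟨le_refl 0, zero_le_one⟩ x
  rwa [slide_zero] at this

theorem slideFactor_pos (hp : PosIndexLE p Q) (W : PosGr p Q) {t : ℝ}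
    (ht : t ∈ Set.Icc (0 : ℝ) 1) (x : periodSpace p Q) : 0 < slideFactor W t x := by
  have h : 0 < (√(Q (posProj Q W.1 (posProj Q x.1.1 x.1.2))))⁻¹ :=
    inv_pos.2 (Real.sqrt_pos.2 (apply_posProj_pos hp W x))
  rcases ht.1.eq_or_lt with rfl | h0
  · simpa [slideFactor] using h
  · have := mul_nonneg (sub_nonneg.2 ht.2) h.le
    unfold slideFactor
    linarith

/-- Slide the plane of `x`, together with the projection of the vector of `x` to this plane, to
`W`. At `t = 1` this is `straighten 1`, and at `t = 0` the result is a unit vector of `W`. -/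
noncomputable def slideTo (hp : PosIndexLE p Q) (W : PosGr p Q) (t : unitInterval)
    (x : periodSpace p Q) : periodSpace p Q :=
  ⟨(((posPlane x).push (slide Q W.1 t) (le_apply_slide hp W.2 t.2)).1,
      slideFactor W t x • slide Q W.1 t (posProj Q x.1.1 x.1.2)), by
    refine mem_periodSpace_iff.2
      ⟨((posPlane x).push (slide Q W.1 t) (le_apply_slide hp W.2 t.2)).2, ?_⟩
    have h1 := apply_slide_pos hp W t.2 x
    have h2 : slide Q W.1 t (posProj Q x.1.1 x.1.2) ≠ 0 := by
      intro h
      rw [h, QuadraticMap.map_zero] at h1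
      exact lt_irrefl _ h1
    rw [posProj_of_mem ((posPlane x).push (slide Q W.1 t) (le_apply_slide hp W.2 t.2)).2]
    · exact smul_ne_zero (slideFactor_pos hp W t.2 x).ne' h2
    · exact Submodule.smul_mem _ _ (PosGr.apply_mem_push (posProj_mem _ _))⟩

theorem straighten_zero (x : periodSpace p Q) : straighten 0 x = x :=
  Subtype.ext (Prod.ext rfl (by simp [straighten]))

theorem slideTo_one (hp : PosIndexLE p Q) (W : PosGr p Q) (x : periodSpace p Q) :
    slideTo hp W 1 x = straighten 1 x := by
  refine Subtype.ext (Prod.ext ?_ ?_)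
  · refine congrArg Subtype.val (PosGr.push_eq_of_mem
      (hT := le_apply_slide hp W.2 (1 : unitInterval).2) (W := posPlane x)
      (W' := posPlane x) fun y hy => ?_)
    simpa [slide_one] using hy
  · simp [slideTo, straighten, slideFactor, slide_one]

/-- The unit vectors of `W`, as a subset of the period space. -/
def unitSphere (W : PosGr p Q) : Set (periodSpace p Q) :=
  {x | x.1.1 = W.1 ∧ x.1.2 ∈ W.1.1 ∧ Q x.1.2 = 1}

theorem slideTo_zero_mem (hp : PosIndexLE p Q) (W : PosGr p Q) (x : periodSpace p Q) :
    slideTo hp W 0 x ∈ unitSphere W := by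
  have h1 : (posPlane x).push (slide Q W.1 (0 : unitInterval))
      (le_apply_slide hp W.2 (0 : unitInterval).2) = W := slide_zero_push _ _ _
  have e : slide Q W.1 ((0 : unitInterval) : ℝ) = posProj Q W.1 := slide_zero _
  refine ⟨congrArg Subtype.val h1, ?_, ?_⟩
  · refine Submodule.smul_mem _ _ ?_
    rw [e]
    exact posProj_mem _ _
  · change Q (slideFactor W _ x • slide Q W.1 _ (posProj Q x.1.1 x.1.2)) = 1
    have hpos := apply_posProj_pos hp W x
    rw [e, QuadraticMap.map_smul, smul_eq_mul]
    simp only [slideFactor, Set.Icc.coe_zero, sub_zero, one_mul, zero_add]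
    rw [← mul_inv, Real.mul_self_sqrt hpos.le, inv_mul_cancel₀ hpos.ne']

theorem slideTo_zero_of_mem (hp : PosIndexLE p Q) (W : PosGr p Q) {x : periodSpace p Q}
    (hx : x ∈ unitSphere W) : slideTo hp W 0 x = x := by
  refine Subtype.ext (Prod.ext ((slideTo_zero_mem hp W x).1.trans hx.1.symm) ?_)
  change slideFactor W _ x • slide Q W.1 _ (posProj Q x.1.1 x.1.2) = x.1.2
  simp only [slideFactor, Set.Icc.coe_zero, slide_zero, sub_zero, one_mul, zero_add]
  rw [hx.1, posProj_of_mem W.2 hx.2.1, posProj_of_mem W.2 hx.2.1, hx.2.2]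
  simp

/-! ### Naturality under isometries -/

section Naturality

variable {V' : Type u} [AddCommGroup V'] [Module ℝ V'] {Q' : QuadraticForm ℝ V'}
  (e : V ≃ₗ[ℝ] V') (he : ∀ x, Q' (e x) = Q x)

include he

theorem polar_map (x y : V) : polar Q' (e x) (e y) = polar Q x y := by
  simp only [polar, ← map_add, he]

theorem posDef_map {W : Gr p V} (hW : (Q.restrict W.1).PosDef) :
    (Q'.restrict (Gr.map e W).1).PosDef := by
  rintro ⟨_, x, hx, rfl⟩ h0
  change 0 < Q' (e x)
  rw [he]
  exact pos_of_mem hW hx fun h => h0 (Subtype.ext (by simp [h]))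

theorem posProj_map {W : Gr p V} (hW : (Q.restrict W.1).PosDef) (x : V) :
    posProj Q' (Gr.map e W) (e x) = e (posProj Q W x) := by
  refine posProj_eq_of_polar (posDef_map e he hW) ⟨_, posProj_mem W x, rfl⟩ ?_
  rintro _ ⟨w, hw, rfl⟩
  change polar Q' (e x - e (posProj Q W x)) (e w) = 0
  rw [← map_sub, polar_map e he, polar_sub_posProj hW x hw]

theorem slide_map {W : Gr p V} (hW : (Q.restrict W.1).PosDef) (t : ℝ) (x : V) :
    slide Q' (Gr.map e W) t (e x) = e (slide Q W t x) := by
  simp only [slide_apply, posProj_map e he hW, map_add, map_smul]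

theorem posIndexLE_map (hp : PosIndexLE p Q) : PosIndexLE p Q' := by
  intro W hW x hx
  have he' : ∀ x, Q (e.symm x) = Q' x := fun x => by rw [← he, e.apply_symm_apply]
  rw [← he' x]
  refine hp (Gr.map e.symm W) (posDef_map e.symm he' hW) _ ?_
  rintro _ ⟨w, hw, rfl⟩
  exact (polar_map e.symm he' x w).trans (hx w hw)

theorem map_mem_periodSpace {x : Gr p V × V} (hx : x ∈ periodSpace p Q) :
    (Gr.map e x.1, e x.2) ∈ periodSpace p Q' := by
  rw [mem_periodSpace_iff] at hx ⊢
  refine ⟨posDef_map e he hx.1, ?_⟩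
  change posProj Q' (Gr.map e x.1) (e x.2) ≠ 0
  rw [posProj_map e he hx.1]
  exact e.map_ne_zero_iff.2 hx.2

omit he in
variable (p) in
theorem Gr.map_symm_map (W : Gr p V) : Gr.map e.symm (Gr.map e W) = W :=
  Subtype.ext (by
    change (W.1.map e.toLinearMap).map e.symm.toLinearMap = W.1
    rw [← Submodule.map_comp]
    simp)

omit he in
theorem Gr.map_injective : Function.Injective (Gr.map e : Gr p V → Gr p V') :=
  Function.LeftInverse.injective (Gr.map_symm_map p e)

/-- The map of positive Grassmannians induced by an isometry. -/
def PosGr.map (W : PosGr p Q) : PosGr p Q' := ⟨Gr.map e W.1, posDef_map e he W.2⟩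

/-- The map of period spaces induced by an isometry. -/
def periodMap (x : periodSpace p Q) : periodSpace p Q' :=
  ⟨(Gr.map e x.1.1, e x.1.2), map_mem_periodSpace e he x.2⟩

theorem periodMap_straighten (s : ℝ) (x : periodSpace p Q) :
    periodMap e he (straighten s x) = straighten s (periodMap e he x) := by
  refine Subtype.ext (Prod.ext rfl ?_)
  simp [periodMap, straighten, posProj_map e he x.2.1]

theorem PosGr.map_push {T : V →ₗ[ℝ] V} {T' : V' →ₗ[ℝ] V'} (hT : ∀ x, Q x ≤ Q (T x))
    (hT' : ∀ x, Q' x ≤ Q' (T' x)) (h : ∀ x, T' (e x) = e (T x)) (W : PosGr p Q) :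
    (W.push T hT).map e he = (W.map e he).push T' hT' := by
  refine (PosGr.push_eq_of_mem ?_).symm
  rintro _ ⟨x, hx, rfl⟩
  exact ⟨T x, ⟨x, hx, rfl⟩, (h x).symm⟩

theorem periodMap_slideTo (hp : PosIndexLE p Q) (hp' : PosIndexLE p Q') (W : PosGr p Q)
    (t : unitInterval) (x : periodSpace p Q) :
    periodMap e he (slideTo hp W t x) = slideTo hp' (W.map e he) t (periodMap e he x) := by
  refine Subtype.ext (Prod.ext ?_ ?_)
  · exact congrArg Subtype.val (PosGr.map_push e he (le_apply_slide hp W.2 t.2)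
      (le_apply_slide hp' (W.map e he).2 t.2) (fun y => slide_map e he W.2 t y) (posPlane x))
  · have h1 := posProj_map e he x.2.1 x.1.2
    have h2 := fun y => posProj_map e he W.2 y
    have h3 := fun y => slide_map e he W.2 t y
    change e (slideFactor W t x • slide Q W.1 t (posProj Q x.1.1 x.1.2)) =
      slideFactor (W.map e he) t (periodMap e he x) •
        slide Q' (Gr.map e W.1) t (posProj Q' (Gr.map e x.1.1) (e x.1.2))
    have h4 : slideFactor (W.map e he) t (periodMap e he x) = slideFactor W t x := by
      change t + (1 - t) * (√(Q' (posProj Q' (Gr.map e W.1)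
        (posProj Q' (Gr.map e x.1.1) (e x.1.2)))))⁻¹ = _
      rw [h1, h2, he]
      rfl
    rw [h4, h1, h3, map_smul]

theorem periodMap_mem_unitSphere {W : PosGr p Q} {x : periodSpace p Q} :
    periodMap e he x ∈ unitSphere (W.map e he) ↔ x ∈ unitSphere W := by
  refine and_congr (Gr.map_injective e).eq_iff (and_congr ?_ ?_)
  · change e x.1.2 ∈ W.1.1.map e.toLinearMap ↔ _
    exact Submodule.mem_map.trans ⟨fun ⟨y, hy, h⟩ => e.injective h ▸ hy, fun h => ⟨_, h, rfl⟩⟩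
  · change Q' (e x.1.2) = 1 ↔ _
    rw [he]

end Naturality

end QuadraticSpace

/-! ### Continuity on the Grassmannian -/

section GrTopology

open QuadraticMap Topology

variable {V : Type u} [AddCommGroup V] [Module ℝ V] [TopologicalSpace V] {p : ℕ}

theorem Gr.continuous_span :
    Continuous (Gr.span : {v : Fin p → V // LinearIndependent ℝ v} → Gr p V) :=
  continuous_coinduced_rng

theorem continuous_frame_apply (i : Fin p) :
    Continuous fun v : {v : Fin p → V // LinearIndependent ℝ v} => v.1 i :=
  (continuous_apply i).comp continuous_subtype_val

theorem Gr.continuous_map {V' : Type u} [AddCommGroup V'] [Module ℝ V'] [TopologicalSpace V']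
    (e : V ≃ₗ[ℝ] V') (he : Continuous e) : Continuous (Gr.map e : Gr p V → Gr p V') := by
  refine continuous_coinduced_dom.2 ?_
  have h : (Gr.map e ∘ Gr.span : {v : Fin p → V // LinearIndependent ℝ v} → Gr p V') =
      Gr.span ∘ fun v => ⟨fun i => e (v.1 i), v.2.map' e.toLinearMap e.ker⟩ := by
    funext v
    refine Subtype.ext ?_
    change (Submodule.span ℝ (Set.range v.1)).map e.toLinearMap =
      Submodule.span ℝ (Set.range (e ∘ v.1))
    rw [Set.range_comp]
    exact Submodule.map_span _ _
  rw [h]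
  exact Gr.continuous_span.comp (continuous_induced_rng.2 (continuous_pi fun i =>
    he.comp (continuous_frame_apply i)))

variable {Q : QuadraticForm ℝ V}

variable (p Q) in
/-- The space of frames of positive definite `p`-planes. -/
abbrev PosFrame : Type u :=
  {v : {v : Fin p → V // LinearIndependent ℝ v} // (Q.restrict (Gr.span v).1).PosDef}

/-- The plane spanned by a frame. -/
noncomputable def PosFrame.span (v : PosFrame p Q) : PosGr p Q := ⟨Gr.span v.1, v.2⟩

theorem continuous_frameCoord (hQ : Continuous fun x : V × V => polar Q x.1 x.2) {Y : Type*}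
    [TopologicalSpace Y] {v : Y → PosFrame p Q} (hv : Continuous v) {x : Y → V}
    (hx : Continuous x) : Continuous fun y => frameCoord Q (v y).1.1 (x y) := by
  have hvi (i : Fin p) : Continuous fun y => (v y).1.1 i :=
    (continuous_apply i).comp (continuous_subtype_val.comp (continuous_subtype_val.comp hv))
  have hG : Continuous fun y => gramMatrix Q (v y).1.1 :=
    continuous_matrix fun i j => hQ.comp ((hvi i).prodMk (hvi j))
  have hdet (y : Y) : (gramMatrix Q (v y).1.1).det ≠ 0 :=
    (isUnit_det_gramMatrix (v y).1.2 (v y).2).ne_zero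
  have hinv : Continuous fun y => (gramMatrix Q (v y).1.1)⁻¹ := by
    simp only [Matrix.inv_def, Ring.inverse_eq_inv']
    exact (hG.matrix_det.inv₀ hdet).smul hG.matrix_adjugate
  simp only [frameCoord_apply]
  exact hinv.matrix_mulVec (continuous_pi fun i => hQ.comp ((hvi i).prodMk hx))

theorem continuous_posPlane : Continuous (posPlane : periodSpace p Q → PosGr p Q) :=
  continuous_induced_rng.2 (continuous_fst.comp continuous_subtype_val)

theorem continuous_quadraticForm (hQ : Continuous fun x : V × V => polar Q x.1 x.2) :
    Continuous Q := by
  have h (x : V) : Q x = 2⁻¹ * polar Q x x := by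
    rw [two_mul_apply_eq_polar]
    ring
  have h2 := hQ.comp (f := fun x : V => (x, x)) (by fun_prop)
  rw [show (Q : V → ℝ) = fun x => 2⁻¹ * polar Q x x from funext h]
  exact continuous_const.mul h2

variable [ContinuousAdd V] [ContinuousSMul ℝ V]

/-- Two frames of the same subspace differ by an invertible matrix, and multiplication by this
matrix is a homeomorphism of the space of frames that preserves spans. -/
theorem Gr.isOpenQuotientMap_span :
    IsOpenQuotientMap (Gr.span : {v : Fin p → V // LinearIndependent ℝ v} → Gr p V) := by
  refine ⟨Gr.span_surjective, Gr.continuous_span, fun O hO => isOpen_coinduced.2 ?_⟩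
  obtain ⟨O', hO', rfl⟩ := isOpen_induced_iff.1 hO
  refine isOpen_iff_mem_nhds.2 ?_
  rintro v ⟨w, hw, hwv⟩
  have hspan : Submodule.span ℝ (Set.range w.1) = Submodule.span ℝ (Set.range v.1) :=
    congrArg Subtype.val hwv
  have hmem (i : Fin p) : w.1 i ∈ Submodule.span ℝ (Set.range v.1) :=
    hspan ▸ Submodule.subset_span ⟨i, rfl⟩
  choose g hg using fun i => (Submodule.mem_span_range_iff_exists_fun ℝ).1 (hmem i)
  have hsum (u : Fin p → V) (c : Fin p → ℝ) :
      ∑ i, c i • ∑ j, g i j • u j = ∑ j, Matrix.vecMul c (Matrix.of g) j • u j := by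
    simp only [Finset.smul_sum, Matrix.vecMul, dotProduct, Finset.sum_smul, smul_smul,
      Matrix.of_apply]
    exact Finset.sum_comm
  have hinj (c : Fin p → ℝ) (hc : Matrix.vecMul c (Matrix.of g) = 0) : c = 0 := by
    have h := hsum v.1 c
    simp only [hg, hc, Pi.zero_apply, zero_smul, Finset.sum_const_zero] at h
    exact funext fun i => Fintype.linearIndependent_iff.1 w.2 c h i
  have hli (u : Fin p → V) (hu : LinearIndependent ℝ u) :
      LinearIndependent ℝ fun i => ∑ j, g i j • u j := by
    rw [Fintype.linearIndependent_iff]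
    intro c hc
    rw [hsum] at hc
    exact congrFun (hinj c (funext fun j => Fintype.linearIndependent_iff.1 hu _ hc j))
  have hcont : Continuous fun u : {v : Fin p → V // LinearIndependent ℝ v} =>
      fun i => ∑ j, g i j • u.1 j :=
    continuous_pi fun i => continuous_finsetSum _ fun j _ =>
      continuous_const.smul (continuous_frame_apply j)
  have hv : (fun i => ∑ j, g i j • v.1 j) ∈ O' := by
    have : (fun i => ∑ j, g i j • v.1 j) = w.1 := funext hg
    rw [this]
    exact hw
  filter_upwards [hcont.continuousAt.preimage_mem_nhds (hO'.mem_nhds hv)] with u hu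
  refine ⟨⟨_, hli u.1 u.2⟩, hu, Gr.eq_of_le ?_⟩
  change Submodule.span ℝ (Set.range _) ≤ Submodule.span ℝ (Set.range u.1)
  rw [Submodule.span_le]
  rintro _ ⟨i, rfl⟩
  have hsub (j : Fin p) : u.1 j ∈ Submodule.span ℝ (Set.range u.1) := Submodule.subset_span ⟨j, rfl⟩
  change ∑ j, g i j • u.1 j ∈ Submodule.span ℝ (Set.range u.1)
  exact Submodule.sum_mem _ fun j _ => Submodule.smul_mem _ _ (hsub j)

theorem PosFrame.isOpenQuotientMap_span : IsOpenQuotientMap (PosFrame.span (p := p) (Q := Q)) :=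
  Gr.isOpenQuotientMap_span.restrictPreimage {W : Gr p V | (Q.restrict W.1).PosDef}

theorem continuous_posProj (hQ : Continuous fun x : V × V => polar Q x.1 x.2) :
    Continuous fun x : PosGr p Q × V => posProj Q x.1.1 x.2 := by
  refine ((PosFrame.isOpenQuotientMap_span (p := p) (Q := Q)).prodMap
    (.id (X := V))).continuous_comp_iff.1 ?_
  have h : (fun x : PosGr p Q × V => posProj Q x.1.1 x.2) ∘ Prod.map PosFrame.span id =
      fun x : PosFrame p Q × V => ∑ j, frameCoord Q x.1.1.1 x.2 j • x.1.1.1 j := by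
    funext x
    change posProj Q (Gr.span x.1.1) x.2 = _
    rw [posProj_span x.1.1 x.1.2, frameProj_apply]
  rw [h]
  refine continuous_finsetSum _ fun j _ => ?_
  refine ((continuous_apply j).comp
    (continuous_frameCoord hQ continuous_fst continuous_snd)).smul ?_
  exact (continuous_frame_apply j).comp (continuous_subtype_val.comp continuous_fst)

/-- Continuity is tested on frames, because the span of a frame is an open quotient map. -/
theorem continuous_push {A : Type*} [TopologicalSpace A] {T : A → V →ₗ[ℝ] V}
    (hT : ∀ a x, Q x ≤ Q (T a x)) (hcont : Continuous fun x : A × V => T x.1 x.2) :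
    Continuous fun x : A × PosGr p Q => x.2.push (T x.1) (hT x.1) := by
  refine ((IsOpenQuotientMap.id (X := A)).prodMap
    (PosFrame.isOpenQuotientMap_span (p := p) (Q := Q))).continuous_comp_iff.1 ?_
  refine continuous_induced_rng.2 ?_
  have hli (x : A × PosFrame p Q) := PosGr.push_span (T x.1) (hT x.1) x.2.span x.2.1 rfl
  have h : (Subtype.val ∘ (fun x : A × PosGr p Q => x.2.push (T x.1) (hT x.1)) ∘
      Prod.map id PosFrame.span) = Gr.span ∘ fun x : A × PosFrame p Q =>
        ⟨fun i => T x.1 (x.2.1.1 i), (hli x).choose⟩ :=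
    funext fun x => (hli x).choose_spec
  rw [h]
  refine Gr.continuous_span.comp (continuous_induced_rng.2 (continuous_pi fun i => ?_))
  exact hcont.comp (f := fun x : A × PosFrame p Q => (x.1, x.2.1.1 i)) (continuous_fst.prodMk
    ((continuous_frame_apply i).comp (continuous_subtype_val.comp continuous_snd)))

theorem continuous_projVector (hQ : Continuous fun x : V × V => polar Q x.1 x.2) :
    Continuous fun x : periodSpace p Q => posProj Q x.1.1 x.1.2 :=
  (continuous_posProj (p := p) hQ).comp (f := fun x : periodSpace p Q => (posPlane x, x.1.2))
    (continuous_posPlane.prodMk (continuous_snd.comp continuous_subtype_val))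

theorem continuous_slide (hQ : Continuous fun x : V × V => polar Q x.1 x.2) :
    Continuous fun x : (ℝ × PosGr p Q) × V => slide Q x.1.2.1 x.1.1 x.2 := by
  simp only [slide_apply]
  have := (continuous_posProj (p := p) hQ).comp
    (f := fun x : (ℝ × PosGr p Q) × V => (x.1.2, x.2)) (by fun_prop)
  simp only [Function.comp_def] at this
  fun_prop

theorem continuous_straighten [ContinuousSub V]
    (hQ : Continuous fun x : V × V => polar Q x.1 x.2) :
    Continuous fun x : ℝ × periodSpace p Q => straighten x.1 x.2 := by
  have := (continuous_projVector (p := p) hQ).comp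
    (f := fun x : ℝ × periodSpace p Q => x.2) continuous_snd
  simp only [Function.comp_def] at this
  exact continuous_induced_rng.2 (.prodMk (by fun_prop) (by fun_prop))

theorem continuous_slideTo (hp : PosIndexLE p Q)
    (hQ : Continuous fun x : V × V => polar Q x.1 x.2) :
    Continuous fun x : (unitInterval × PosGr p Q) × periodSpace p Q =>
      slideTo hp x.1.2 x.1.1 x.2 := by
  have hproj := (continuous_projVector (p := p) hQ).comp
    (f := fun x : (unitInterval × PosGr p Q) × periodSpace p Q => x.2) continuous_snd
  have hproj2 := (continuous_posProj (p := p) hQ).comp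
    (f := fun x : (unitInterval × PosGr p Q) × periodSpace p Q =>
      (x.1.2, posProj Q x.2.1.1 x.2.1.2)) (.prodMk (by fun_prop) hproj)
  have hslide := (continuous_slide (p := p) hQ).comp
    (f := fun x : (unitInterval × PosGr p Q) × periodSpace p Q =>
      (((x.1.1 : ℝ), x.1.2), posProj Q x.2.1.1 x.2.1.2)) (.prodMk (by fun_prop) hproj)
  have hnorm := ((continuous_quadraticForm hQ).comp hproj2).sqrt.inv₀ fun x =>
    (Real.sqrt_pos.2 (apply_posProj_pos hp x.1.2 x.2)).ne'
  refine continuous_induced_rng.2 (.prodMk ?_ ?_)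
  · have hpush := continuous_push (p := p) (Q := Q)
      (T := fun a : unitInterval × PosGr p Q => slide Q a.2.1 a.1)
      (fun a x => le_apply_slide hp a.2.2 a.1.2 x)
      ((continuous_slide hQ).comp (f := fun x : (unitInterval × PosGr p Q) × V =>
        (((x.1.1 : ℝ), x.1.2), x.2)) (by fun_prop))
    exact continuous_subtype_val.comp (hpush.comp (f := fun x :
      (unitInterval × PosGr p Q) × periodSpace p Q => (x.1, posPlane x.2))
      (.prodMk continuous_fst (continuous_posPlane.comp continuous_snd)))
  · refine Continuous.smul ?_ hslide
    have ht : Continuous fun x : (unitInterval × PosGr p Q) × periodSpace p Q => (x.1.1 : ℝ) := by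
      fun_prop
    exact ht.add ((continuous_const.sub ht).mul hnorm)

end GrTopology

/-! ### Flat bundles of quadratic spaces -/

section FlatBundle

open QuadraticMap Topology

variable {B : Type v} [TopologicalSpace B] {V : Type u} [AddCommGroup V] [Module ℝ V] {p : ℕ}

/-- A flat atlas on a family `(E b, Q b)` of quadratic spaces: over the members of an open cover
`U i` of the base, the fibres are identified with `(V, Q₀)`, and the transition maps are locally
constant. The fibres carry no topology of their own. -/
structure FlatAtlas (ι : Type*) (Q₀ : QuadraticForm ℝ V) {E : B → Type u}
    [∀ b, AddCommGroup (E b)] [∀ b, Module ℝ (E b)] (Q : ∀ b, QuadraticForm ℝ (E b)) where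
  U : ι → Set B
  isOpen_U : ∀ i, IsOpen (U i)
  exists_mem : ∀ b, ∃ i, b ∈ U i
  equiv : ∀ (i : ι) {b : B}, b ∈ U i → V ≃ₗ[ℝ] E b
  isometry : ∀ (i : ι) {b : B} (hb : b ∈ U i) (x : V), Q b (equiv i hb x) = Q₀ x
  eventually_eq : ∀ (i j : ι) {b₀ : B} (hi : b₀ ∈ U i) (hj : b₀ ∈ U j),
    ∀ᶠ b in 𝓝 b₀, ∀ (hi' : b ∈ U i) (hj' : b ∈ U j) (x : V),
      (equiv j hj').symm (equiv i hi' x) = (equiv j hj).symm (equiv i hi x)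

variable {ι : Type*} {Q₀ : QuadraticForm ℝ V} {E : B → Type u}
  [∀ b, AddCommGroup (E b)] [∀ b, Module ℝ (E b)] {Q : ∀ b, QuadraticForm ℝ (E b)}
  (A : FlatAtlas ι Q₀ Q)

theorem PosGr.push_push {S T : V →ₗ[ℝ] V} (hS : ∀ x, Q₀ x ≤ Q₀ (S x)) (hT : ∀ x, Q₀ x ≤ Q₀ (T x))
    (hTS : ∀ x, Q₀ x ≤ Q₀ ((T.comp S) x)) (W : PosGr p Q₀) :
    (W.push S hS).push T hT = W.push (T.comp S) hTS := by
  refine (PosGr.push_eq_of_mem ?_).symm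
  intro x hx
  exact PosGr.apply_mem_push (PosGr.apply_mem_push hx)

namespace FlatAtlas

include A in
theorem posIndexLE (hp : PosIndexLE p Q₀) (b : B) : PosIndexLE p (Q b) := by
  obtain ⟨i, hi⟩ := A.exists_mem b
  exact posIndexLE_map (A.equiv i hi) (A.isometry i hi) hp

open Classical in
/-- The endomorphism of `E b` that slides, by the amount `f b`, towards the plane that is constantly
`W` in the chart `U i`. Outside of `U i` it is the identity. -/
noncomputable def localSlide (W : PosGr p Q₀) (a : ι × (B → ℝ)) (b : B) : E b →ₗ[ℝ] E b :=
  if h : b ∈ A.U a.1 then slide (Q b) (Gr.map (A.equiv a.1 h) W.1) (1 - a.2 b) else LinearMap.id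

/-- The composition of the slides of a list. -/
noncomputable def totalSlide (W : PosGr p Q₀) (b : B) : List (ι × (B → ℝ)) → (E b →ₗ[ℝ] E b)
  | [] => LinearMap.id
  | a :: L => (A.localSlide W a b).comp (totalSlide W b L)

theorem localSlide_of_mem (W : PosGr p Q₀) (a : ι × (B → ℝ)) {b : B} (h : b ∈ A.U a.1) :
    A.localSlide W a b = slide (Q b) (Gr.map (A.equiv a.1 h) W.1) (1 - a.2 b) := dif_pos h

theorem le_apply_localSlide (hp : PosIndexLE p Q₀) (W : PosGr p Q₀) {a : ι × (B → ℝ)} {b : B}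
    (ha : a.2 b ∈ Set.Icc (0 : ℝ) 1) (x : E b) : Q b x ≤ Q b (A.localSlide W a b x) := by
  unfold localSlide
  split_ifs with h
  · exact le_apply_slide (A.posIndexLE hp b) (posDef_map _ (A.isometry a.1 h) W.2)
      ⟨sub_nonneg.2 ha.2, sub_le_self _ ha.1⟩ x
  · exact le_rfl

theorem le_apply_totalSlide (hp : PosIndexLE p Q₀) (W : PosGr p Q₀) {b : B}
    {L : List (ι × (B → ℝ))} (hL : ∀ a ∈ L, a.2 b ∈ Set.Icc (0 : ℝ) 1) (x : E b) :
    Q b x ≤ Q b (A.totalSlide W b L x) := by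
  induction L with
  | nil => exact le_rfl
  | cons a L ih =>
    exact (ih fun a' ha' => hL a' (List.mem_cons_of_mem _ ha')).trans
      (A.le_apply_localSlide hp W (hL a List.mem_cons_self) _)

/-- A composition of slides one of which is a projection maps all positive definite `p`-planes to
the same plane, because the projection does. -/
theorem push_totalSlide_eq (hp : PosIndexLE p Q₀) (W : PosGr p Q₀) {b : B}
    {L : List (ι × (B → ℝ))} (hL : ∀ a ∈ L, a.2 b ∈ Set.Icc (0 : ℝ) 1)
    (h1 : ∃ a ∈ L, b ∈ A.U a.1 ∧ a.2 b = 1) (W₁ W₂ : PosGr p (Q b)) :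
    W₁.push (A.totalSlide W b L) (A.le_apply_totalSlide hp W hL) =
      W₂.push (A.totalSlide W b L) (A.le_apply_totalSlide hp W hL) := by
  induction L with
  | nil => simp at h1
  | cons a L ih =>
    have hL' : ∀ a ∈ L, a.2 b ∈ Set.Icc (0 : ℝ) 1 :=
      fun a' ha' => hL a' (List.mem_cons_of_mem _ ha')
    obtain ⟨a', ha', hU, h⟩ := h1
    rcases List.mem_cons.1 ha' with rfl | ha'
    · have key (W' : PosGr p (Q b)) : W'.push (A.totalSlide W b (a' :: L))
          (A.le_apply_totalSlide hp W hL) = W.map (A.equiv a'.1 hU) (A.isometry a'.1 hU) := by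
        refine PosGr.push_eq_of_mem fun x _ => ?_
        change A.localSlide W a' b (A.totalSlide W b L x) ∈ _
        rw [A.localSlide_of_mem W a' hU, h, sub_self, slide_zero]
        exact posProj_mem _ _
      rw [key, key]
    · have := ih hL' ⟨a', ha', hU, h⟩
      have h2 := A.le_apply_localSlide hp W (hL a List.mem_cons_self)
      have h3 := PosGr.push_push (p := p) (A.le_apply_totalSlide hp W hL') h2
        (A.le_apply_totalSlide hp W hL)
      exact (h3 W₁).symm.trans ((congrArg (PosGr.push _ h2) this).trans (h3 W₂))

/-- A finite list of charts with cutoff functions, one of which is `1` at any given point. -/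
theorem exists_cutoffs [CompactSpace B] [T2Space B] :
    ∃ L : List (ι × (B → ℝ)), (∀ a ∈ L, Continuous a.2) ∧ (∀ a ∈ L, tsupport a.2 ⊆ A.U a.1) ∧
      (∀ a ∈ L, ∀ b, a.2 b ∈ Set.Icc (0 : ℝ) 1) ∧ ∀ b, ∃ a ∈ L, b ∈ A.U a.1 ∧ a.2 b = 1 := by
  have hloc (b : B) : ∃ a : ι × (B → ℝ), Continuous a.2 ∧ tsupport a.2 ⊆ A.U a.1 ∧
      (∀ b, a.2 b ∈ Set.Icc (0 : ℝ) 1) ∧ ∃ N ∈ 𝓝 b, ∀ b' ∈ N, b' ∈ A.U a.1 ∧ a.2 b' = 1 := by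
    obtain ⟨i, hi⟩ := A.exists_mem b
    obtain ⟨N, hN, hNc, hNU⟩ := exists_mem_nhds_isClosed_subset ((A.isOpen_U i).mem_nhds hi)
    obtain ⟨f, hf1, hf2, hf3⟩ := exists_tsupport_one_of_isOpen_isClosed (A.isOpen_U i)
      isClosed_closure.isCompact hNc hNU
    exact ⟨(i, f), f.continuous, hf1, hf3, N, hN, fun b' hb' => ⟨hNU hb', hf2 hb'⟩⟩
  choose a ha1 ha2 ha3 N hN hN' using hloc
  obtain ⟨t, ht⟩ := CompactSpace.elim_nhds_subcover N hN
  refine ⟨t.toList.map a, ?_, ?_, ?_, ?_⟩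
  · simpa using fun b _ => ha1 b
  · simpa using fun b _ => ha2 b
  · simpa using fun b _ => ha3 b
  · intro b
    have hb : b ∈ ⋃ x ∈ t, N x := ht ▸ Set.mem_univ b
    obtain ⟨c, hc, hbc⟩ := Set.mem_iUnion₂.1 hb
    exact ⟨a c, List.mem_map.2 ⟨c, Finset.mem_toList.2 hc, rfl⟩, hN' c b hbc⟩

variable [TopologicalSpace V] [IsModuleTopology ℝ V] [IsTopologicalAddGroup V]
  [ContinuousSMul ℝ V]

/-- At a point of `U a.1` the charts `i` and `a.1` differ by a constant map nearby, and at all other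
points the cutoff function vanishes nearby. -/
theorem continuous_localSlide (W : PosGr p Q₀) {a : ι × (B → ℝ)} (hc : Continuous a.2)
    (hs : tsupport a.2 ⊆ A.U a.1) (i : ι) :
    Continuous fun x : A.U i × V =>
      (A.equiv i x.1.2).symm (A.localSlide W a x.1 (A.equiv i x.1.2 x.2)) := by
  refine continuous_iff_continuousAt.2 fun x₀ => ?_
  have hfst : Filter.Tendsto (fun x : A.U i × V => (x.1 : B)) (𝓝 x₀) (𝓝 x₀.1) :=
    (continuous_subtype_val.comp continuous_fst).continuousAt
  by_cases h₀ : (x₀.1 : B) ∈ A.U a.1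
  · set N : V →ₗ[ℝ] V := (A.equiv i x₀.1.2).symm.toLinearMap ∘ₗ (A.equiv a.1 h₀).toLinearMap ∘ₗ
      posProj Q₀ W.1 ∘ₗ (A.equiv a.1 h₀).symm.toLinearMap ∘ₗ (A.equiv i x₀.1.2).toLinearMap with hN
    have hNc : Continuous N := IsModuleTopology.continuous_of_linearMap N
    have hcont : Continuous fun x : A.U i × V => (1 - a.2 x.1) • x.2 + a.2 x.1 • N x.2 := by
      fun_prop
    refine hcont.continuousAt.congr ?_
    filter_upwards [hfst.eventually (A.eventually_eq i a.1 x₀.1.2 h₀),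
      hfst.eventually (A.eventually_eq a.1 i h₀ x₀.1.2),
      hfst.eventually ((A.isOpen_U a.1).mem_nhds h₀)] with x hx1 hx2 hx3
    replace hx3 : (x.1 : B) ∈ A.U a.1 := hx3
    have e1 : A.equiv i x.1.2 x.2 =
        A.equiv a.1 hx3 ((A.equiv a.1 hx3).symm (A.equiv i x.1.2 x.2)) := by simp
    have e2 : posProj (Q x.1) (Gr.map (A.equiv a.1 hx3) W.1) (A.equiv i x.1.2 x.2) =
        A.equiv a.1 hx3 (posProj Q₀ W.1 ((A.equiv a.1 hx3).symm (A.equiv i x.1.2 x.2))) := by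
      rw [e1, posProj_map _ (A.isometry a.1 hx3) W.2]
      simp
    rw [A.localSlide_of_mem W a hx3, slide_apply, e2, map_add, map_smul, map_smul,
      LinearEquiv.symm_apply_apply, hx1 x.1.2 hx3, hx2 hx3 x.1.2]
    simp [hN]
  · have hzero : ∀ᶠ b in 𝓝 (x₀.1 : B), a.2 b = 0 :=
      (notMem_tsupport_iff_eventuallyEq.1 fun h => h₀ (hs h))
    refine continuous_snd.continuousAt.congr ?_
    filter_upwards [hfst.eventually hzero] with x hx
    have : A.localSlide W a x.1 = LinearMap.id := by
      unfold localSlide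
      split_ifs
      · rw [hx, sub_zero, slide_one]
      · rfl
    simp [this]

theorem continuous_totalSlide (W : PosGr p Q₀) {L : List (ι × (B → ℝ))}
    (hc : ∀ a ∈ L, Continuous a.2) (hs : ∀ a ∈ L, tsupport a.2 ⊆ A.U a.1) (i : ι) :
    Continuous fun x : A.U i × V =>
      (A.equiv i x.1.2).symm (A.totalSlide W x.1 L (A.equiv i x.1.2 x.2)) := by
  induction L with
  | nil => simpa [totalSlide] using continuous_snd
  | cons a L ih =>
    have h1 := A.continuous_localSlide W (hc a List.mem_cons_self) (hs a List.mem_cons_self) i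
    have h2 := ih (fun a' h => hc a' (List.mem_cons_of_mem _ h))
      (fun a' h => hs a' (List.mem_cons_of_mem _ h))
    have h3 := h1.comp (continuous_fst.prodMk h2)
    simpa [Function.comp_def, totalSlide] using h3

/-- A flat bundle of quadratic spaces over a compact Hausdorff base has a continuous family of
positive definite `p`-planes, given in every chart by a continuous frame. -/
theorem exists_posPlane [CompactSpace B] [T2Space B] (hp : PosIndexLE p Q₀) (W : PosGr p Q₀) :
    ∃ P : ∀ b, PosGr p (Q b), ∀ i, ∃ v : A.U i → PosFrame p Q₀, Continuous v ∧
      ∀ b : A.U i, P b = (v b).span.map (A.equiv i b.2) (A.isometry i b.2) := by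
  obtain ⟨L, hLc, hLs, hL01, hL1⟩ := A.exists_cutoffs
  have hle (b : B) := A.le_apply_totalSlide hp W (b := b) fun a ha => hL01 a ha b
  choose k hk using A.exists_mem
  refine ⟨fun b => (W.map (A.equiv (k b) (hk b)) (A.isometry _ (hk b))).push
    (A.totalSlide W b L) (hle b), fun i => ?_⟩
  let T : A.U i → V →ₗ[ℝ] V := fun b =>
    (A.equiv i b.2).symm.toLinearMap ∘ₗ A.totalSlide W b L ∘ₗ (A.equiv i b.2).toLinearMap
  have hTe (b : A.U i) (x : V) :
      A.totalSlide W b L (A.equiv i b.2 x) = A.equiv i b.2 (T b x) := by simp [T]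
  have hT (b : A.U i) (x : V) : Q₀ x ≤ Q₀ (T b x) := by
    rw [← A.isometry i b.2, ← A.isometry i b.2 (T b x), ← hTe]
    exact hle b _
  obtain ⟨w, hw⟩ := Gr.span_surjective W.1
  have hli (b : A.U i) := PosGr.push_span (T b) (hT b) W w hw
  refine ⟨fun b => ⟨⟨fun j => T b (w.1 j), (hli b).choose⟩,
    (hli b).choose_spec ▸ (W.push (T b) (hT b)).2⟩, ?_, fun b => ?_⟩
  · refine continuous_induced_rng.2 (continuous_induced_rng.2 (continuous_pi fun j => ?_))
    exact (A.continuous_totalSlide W hLc hLs i).comp (f := fun b : A.U i => (b, w.1 j))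
      (by fun_prop)
  · have h1 := PosGr.map_push (A.equiv i b.2) (A.isometry i b.2) (hT b) (hle b) (hTe b) W
    refine (A.push_totalSlide_eq hp W (fun a ha => hL01 a ha b) (hL1 b) _
      (W.map (A.equiv i b.2) (A.isometry i b.2))).trans (h1.symm.trans ?_)
    congr 1
    exact Subtype.ext (hli b).choose_spec

end FlatAtlas

end FlatBundle

/-! ### The sphere bundle in the period bundle of a flat bundle -/

section FlatBundle

open QuadraticMap Topology

/-- A bundle is locally trivial if it has local parametrizations that are open embeddings. -/
theorem isFibreBundle_of_isOpenEmbedding {F S B : Type*} [TopologicalSpace F] [Nonempty F]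
    [TopologicalSpace S] [TopologicalSpace B] {s : S → B}
    (h : ∀ b : B, ∃ U : Set B, IsOpen U ∧ b ∈ U ∧ ∃ ψ : U × F → S, IsOpenEmbedding ψ ∧
      (∀ y, s (ψ y) = y.1) ∧ ∀ x, s x ∈ U → x ∈ Set.range ψ) : IsFibreBundle F s := by
  intro b
  obtain ⟨U, hU, hb, ψ, hψ, hs, hr⟩ := h b
  have : Nonempty (U × F) := ⟨(⟨b, hb⟩, Classical.arbitrary F)⟩
  have hι : IsOpenEmbedding (Prod.map Subtype.val id : U × F → B × F) :=
    hU.isOpenEmbedding_subtypeVal.prodMap .id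
  have hrange : Set.range ψ = s ⁻¹' U := by
    refine Set.Subset.antisymm ?_ hr
    rintro _ ⟨y, rfl⟩
    change s (ψ y) ∈ U
    rw [hs]
    exact y.1.2
  refine ⟨{ toOpenPartialHomeomorph :=
      (hψ.toOpenPartialHomeomorph ψ).symm.trans (hι.toOpenPartialHomeomorph _)
            baseSet := U
            open_baseSet := hU
            source_eq := ?_
            target_eq := ?_
            proj_toFun := ?_ }, hb⟩
  · simp [hrange]
  · simp
  · intro x hx
    have hx : x ∈ Set.range ψ := by simpa using hx
    obtain ⟨y, rfl⟩ := hx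
    have h1 : (hψ.toOpenPartialHomeomorph ψ).symm (ψ y) = y :=
      (hψ.toOpenPartialHomeomorph ψ).left_inv (by simp)
    simp [h1, hs]

variable {B : Type v} [TopologicalSpace B] {V : Type u} [AddCommGroup V] [Module ℝ V] {p : ℕ}
  {ι : Type*} {Q₀ : QuadraticForm ℝ V} {E : B → Type u}
  [∀ b, AddCommGroup (E b)] [∀ b, Module ℝ (E b)] {Q : ∀ b, QuadraticForm ℝ (E b)}
  (A : FlatAtlas ι Q₀ Q)

variable (p Q) in
/-- The total space of the bundle of period spaces. -/
abbrev PeriodTotal : Type (max u v) :=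
  {x : Σ b : B, Gr p (E b) × E b // x.2 ∈ periodSpace p (Q x.1)}

/-- The point `x` of the period space over `b`, as a point of the total space. -/
def PeriodTotal.mk (b : B) (x : periodSpace p (Q b)) : PeriodTotal p Q := ⟨⟨b, x.1⟩, x.2⟩

/-- The component of a point of the total space in its fibre. -/
def PeriodTotal.fibre (x : PeriodTotal p Q) : periodSpace p (Q x.1.1) := ⟨x.1.2, x.2⟩

namespace FlatAtlas

/-- The flat chart of the bundle with fibres `Gr_p(E b) × E b`. -/
def grChart (p : ℕ) (i : ι) (x : A.U i × (Gr p V × V)) : Σ b : B, Gr p (E b) × E b :=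
  ⟨x.1, Gr.map (A.equiv i x.1.2) x.2.1, A.equiv i x.1.2 x.2.2⟩

/-- The flat chart of the bundle of period spaces. -/
def periodChart (p : ℕ) (i : ι) (x : A.U i × periodSpace p Q₀) : PeriodTotal p Q :=
  .mk x.1 (periodMap (A.equiv i x.1.2) (A.isometry i x.1.2) x.2)

theorem exists_periodMap_eq (i : ι) {b : B} (hb : b ∈ A.U i) (x : periodSpace p (Q b)) :
    ∃ y, periodMap (A.equiv i hb) (A.isometry i hb) y = x := by
  have h (y : E b) : Q₀ ((A.equiv i hb).symm y) = Q b y := by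
    rw [← A.isometry i hb, LinearEquiv.apply_symm_apply]
  refine ⟨periodMap (A.equiv i hb).symm h x, Subtype.ext (Prod.ext ?_ ?_)⟩
  · exact Gr.map_symm_map p (A.equiv i hb).symm x.1.1
  · exact (A.equiv i hb).apply_symm_apply _

theorem exists_periodChart_eq (i : ι) (x : PeriodTotal p Q) (hx : x.1.1 ∈ A.U i) :
    ∃ y, A.periodChart p i (⟨x.1.1, hx⟩, y) = x := by
  obtain ⟨y, hy⟩ := A.exists_periodMap_eq i hx x.fibre
  exact ⟨y, congrArg (PeriodTotal.mk x.1.1) hy⟩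

variable [TopologicalSpace V] [TopologicalSpace (Σ b : B, Gr p (E b) × E b)]

theorem isOpenEmbedding_periodChart {i : ι} (hi : IsOpenEmbedding (A.grChart p i)) :
    IsOpenEmbedding (A.periodChart p i) := by
  have hemb : IsEmbedding (A.grChart p i ∘ Prod.map id (Subtype.val : periodSpace p Q₀ → _)) :=
    hi.isEmbedding.comp (IsEmbedding.id.prodMap .subtypeVal)
  have hcont : Continuous (A.periodChart p i) := continuous_induced_rng.2 hemb.continuous
  refine ⟨IsEmbedding.of_comp hcont continuous_subtype_val hemb, ?_⟩
  have hr : Set.range (A.periodChart p i) = Subtype.val ⁻¹' Set.range (A.grChart p i) := by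
    refine Set.Subset.antisymm ?_ ?_
    · rintro _ ⟨y, rfl⟩
      exact ⟨(y.1, y.2.1), rfl⟩
    · rintro x ⟨y, hy⟩
      have hb : (y.1 : B) = x.1.1 := congrArg Sigma.fst hy
      obtain ⟨z, hz⟩ := A.exists_periodChart_eq i x (hb ▸ y.1.2)
      exact ⟨_, hz⟩
  rw [hr]
  exact hi.isOpen_range.preimage continuous_subtype_val

/-- A fibrewise map is continuous if it is so in the flat charts. -/
theorem continuous_fibrewise (hA : ∀ i, IsOpenEmbedding (A.grChart p i)) {T : Type*}
    [TopologicalSpace T] {F : T → ∀ b, periodSpace p (Q b) → periodSpace p (Q b)}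
    (hF : ∀ i, ∃ G : T × (A.U i × periodSpace p Q₀) → periodSpace p Q₀, Continuous G ∧
      ∀ t (b : A.U i) x, F t b (periodMap (A.equiv i b.2) (A.isometry i b.2) x) =
        periodMap (A.equiv i b.2) (A.isometry i b.2) (G (t, b, x))) :
    Continuous fun x : T × PeriodTotal p Q => PeriodTotal.mk _ (F x.1 _ x.2.fibre) := by
  refine continuous_iff_continuousAt.2 ?_
  rintro ⟨t, x⟩
  obtain ⟨i, hi⟩ := A.exists_mem x.1.1
  obtain ⟨z, rfl⟩ : ∃ z, A.periodChart p i z = x :=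
    ⟨_, (A.exists_periodChart_eq i x hi).choose_spec⟩
  obtain ⟨G, hG, hFG⟩ := hF i
  have hemb : IsOpenEmbedding (Prod.map id (A.periodChart p i) : T × _ → T × _) :=
    IsOpenEmbedding.id.prodMap (A.isOpenEmbedding_periodChart (hA i))
  refine (hemb.continuousAt_iff (x := (t, z))).1 ?_
  have h : (fun x : T × PeriodTotal p Q => PeriodTotal.mk _ (F x.1 _ x.2.fibre)) ∘
      Prod.map id (A.periodChart p i) = A.periodChart p i ∘ fun z => (z.2.1, G z) := by
    funext z
    exact congrArg (PeriodTotal.mk _) (hFG z.1 z.2.1 z.2.2)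
  rw [h]
  exact ((A.isOpenEmbedding_periodChart (hA i)).continuous.comp
    ((continuous_fst.comp continuous_snd).prodMk hG)).continuousAt

end FlatAtlas

/-- The total space of the bundle of unit spheres of a family of positive definite planes. -/
abbrev SphereTotal (P : ∀ b, PosGr p (Q b)) : Type (max u v) :=
  {x : PeriodTotal p Q // x.fibre ∈ unitSphere (P x.1.1)}

/-- The bundle of period spaces retracts by deformation, over the base, to the bundle of unit
spheres of a continuous family of positive definite planes: straighten, then slide. -/
theorem FlatAtlas.fibrewiseHomotopyEquivalent [TopologicalSpace V] [IsTopologicalAddGroup V]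
    [ContinuousSMul ℝ V] [TopologicalSpace (Σ b : B, Gr p (E b) × E b)]
    (hA : ∀ i, IsOpenEmbedding (A.grChart p i))
    (hp : PosIndexLE p Q₀) (hQ : Continuous fun x : V × V => polar Q₀ x.1 x.2)
    (P : ∀ b, PosGr p (Q b)) (hP : ∀ i, ∃ v : A.U i → PosFrame p Q₀, Continuous v ∧
      ∀ b : A.U i, P b = (v b).span.map (A.equiv i b.2) (A.isometry i b.2)) :
    FibrewiseHomotopyEquivalent (fun x : PeriodTotal p Q => x.1.1)
      (fun x : SphereTotal P => x.1.1.1) := by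
  have hpb := A.posIndexLE hp
  have c1 : Continuous fun x : unitInterval × PeriodTotal p Q =>
      PeriodTotal.mk _ (straighten x.1 x.2.fibre) := by
    refine A.continuous_fibrewise hA (F := fun (t : unitInterval) b x => straighten t x) fun i =>
      ⟨fun z => straighten z.1 z.2.2, ?_, fun t b x => (periodMap_straighten _ _ _ _).symm⟩
    exact (continuous_straighten hQ).comp
      (f := fun z : unitInterval × (A.U i × periodSpace p Q₀) => ((z.1 : ℝ), z.2.2)) (by fun_prop)
  have c2 : Continuous fun x : unitInterval × PeriodTotal p Q =>
      PeriodTotal.mk _ (slideTo (hpb _) (P _) x.1 x.2.fibre) := by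
    refine A.continuous_fibrewise hA (F := fun t b x => slideTo (hpb b) (P b) t x) fun i => ?_
    obtain ⟨v, hv, hPv⟩ := hP i
    refine ⟨fun z => slideTo hp (v z.2.1).span z.1 z.2.2, ?_, fun t b x => ?_⟩
    · exact (continuous_slideTo hp hQ).comp
        (f := fun z : unitInterval × (A.U i × periodSpace p Q₀) =>
          ((z.1, (v z.2.1).span), z.2.2))
        (.prodMk (continuous_fst.prodMk (PosFrame.isOpenQuotientMap_span.continuous.comp
          (hv.comp (continuous_fst.comp continuous_snd)))) (by fun_prop))
    · rw [hPv, ← periodMap_slideTo]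
  let r₁ : C(PeriodTotal p Q, PeriodTotal p Q) :=
    ⟨_, c1.comp (f := fun x => (1, x)) (by fun_prop)⟩
  let f : C(PeriodTotal p Q, SphereTotal P) :=
    ⟨fun x => ⟨PeriodTotal.mk _ (slideTo (hpb _) (P _) 0 x.fibre),
        slideTo_zero_mem (hpb x.1.1) _ x.fibre⟩,
      continuous_induced_rng.2 (c2.comp (f := fun x => (0, x)) (by fun_prop))⟩
  let g : C(SphereTotal P, PeriodTotal p Q) := ⟨Subtype.val, continuous_subtype_val⟩
  refine ⟨f, g, fun x => rfl, fun x => rfl, ?_, ?_⟩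
  · have h1 : (ContinuousMap.id (PeriodTotal p Q)).HomotopicWith r₁
        (fun h => ∀ x, (h x).1.1 = x.1.1) :=
      ⟨{ toFun := _
         continuous_toFun := c1
         map_zero_left := fun x => congrArg (PeriodTotal.mk _) (straighten_zero x.fibre)
         map_one_left := fun x => rfl
         prop' := fun t x => rfl }⟩
    have h2 : (g.comp f).HomotopicWith r₁ (fun h => ∀ x, (h x).1.1 = x.1.1) :=
      ⟨{ toFun := _
         continuous_toFun := c2
         map_zero_left := fun x => rfl
         map_one_left := fun x => congrArg (PeriodTotal.mk _) (slideTo_one _ _ x.fibre)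
         prop' := fun t x => rfl }⟩
    exact h2.trans h1.symm
  · have h : f.comp g = ContinuousMap.id _ := by
      ext x : 1
      exact Subtype.ext (congrArg (PeriodTotal.mk _) (slideTo_zero_of_mem (hpb _) _ x.2))
    rw [h]
    exact .refl _ fun x => rfl

/-! ### Local triviality of the sphere bundle -/

section Sphere

theorem frame_sum_ne_zero {v : Fin p → V} (hv : LinearIndependent ℝ v)
    (u : Metric.sphere (0 : EuclideanSpace ℝ (Fin p)) 1) : ∑ k, u.1 k • v k ≠ 0 := by
  intro h
  have h0 : u.1 = 0 := by
    ext k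
    exact Fintype.linearIndependent_iff.1 hv _ h k
  have := u.2
  rw [h0] at this
  simp at this

theorem frame_sum_mem (v : PosFrame p Q₀) (c : Fin p → ℝ) :
    ∑ k, c k • v.1.1 k ∈ v.span.1.1 := by
  have h (k : Fin p) : v.1.1 k ∈ v.span.1.1 := Submodule.subset_span ⟨k, rfl⟩
  exact Submodule.sum_mem _ fun k _ => Submodule.smul_mem _ _ (h k)

theorem sum_frameCoord (v : PosFrame p Q₀) {x : V} (hx : x ∈ v.span.1.1) :
    ∑ k, frameCoord Q₀ v.1.1 x k • v.1.1 k = x := by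
  rw [← frameProj_apply, ← posProj_span v.1 v.2]
  exact posProj_of_mem v.2 hx

theorem frameCoord_ne_zero {v : PosFrame p Q₀} {x : periodSpace p Q₀}
    (hx : x ∈ unitSphere v.span) : WithLp.toLp 2 (frameCoord Q₀ v.1.1 x.1.2) ≠ 0 := by
  intro h
  have h' : frameCoord Q₀ v.1.1 x.1.2 = 0 := congrArg WithLp.ofLp h
  have h1 := sum_frameCoord v hx.2.1
  have h2 := hx.2.2
  rw [← h1, h'] at h2
  simp at h2

/-- The direction of the coordinate vector of a unit vector of a positive definite plane. -/
noncomputable def toStdSphere (v : PosFrame p Q₀) (x : unitSphere v.span) :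
    Metric.sphere (0 : EuclideanSpace ℝ (Fin p)) 1 :=
  ⟨‖WithLp.toLp 2 (frameCoord Q₀ v.1.1 x.1.1.2)‖⁻¹ • WithLp.toLp 2 (frameCoord Q₀ v.1.1 x.1.1.2), by
    rw [mem_sphere_zero_iff_norm, norm_smul, norm_inv, norm_norm,
      inv_mul_cancel₀ (norm_ne_zero_iff.2 (frameCoord_ne_zero x.2))]⟩

theorem apply_frame_sum_pos (v : PosFrame p Q₀)
    (u : Metric.sphere (0 : EuclideanSpace ℝ (Fin p)) 1) : 0 < Q₀ (∑ k, u.1 k • v.1.1 k) :=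
  pos_of_mem v.2 (frame_sum_mem v u.1) (frame_sum_ne_zero v.1.2 u)

/-- The unit vector with given direction of its coordinate vector. -/
noncomputable def ofStdSphere (v : PosFrame p Q₀)
    (u : Metric.sphere (0 : EuclideanSpace ℝ (Fin p)) 1) : periodSpace p Q₀ :=
  ⟨(v.span.1, (√(Q₀ (∑ k, u.1 k • v.1.1 k)))⁻¹ • ∑ k, u.1 k • v.1.1 k), by
    refine mem_periodSpace_iff.2 ⟨v.2, ?_⟩
    change posProj Q₀ v.span.1 ((√(Q₀ (∑ k, u.1 k • v.1.1 k)))⁻¹ • ∑ k, u.1 k • v.1.1 k) ≠ 0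
    rw [posProj_of_mem v.span.2 (Submodule.smul_mem _ _ (frame_sum_mem v u.1))]
    exact smul_ne_zero (inv_pos.2 (Real.sqrt_pos.2 (apply_frame_sum_pos v u))).ne'
      (frame_sum_ne_zero v.1.2 u)⟩

theorem ofStdSphere_mem (v : PosFrame p Q₀)
    (u : Metric.sphere (0 : EuclideanSpace ℝ (Fin p)) 1) : ofStdSphere v u ∈ unitSphere v.span := by
  refine ⟨rfl, Submodule.smul_mem _ _ (frame_sum_mem v u.1), ?_⟩
  have h := apply_frame_sum_pos v u
  change Q₀ ((√(Q₀ (∑ k, u.1 k • v.1.1 k)))⁻¹ • ∑ k, u.1 k • v.1.1 k) = 1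
  rw [QuadraticMap.map_smul, smul_eq_mul, ← mul_inv, Real.mul_self_sqrt h.le, inv_mul_cancel₀ h.ne']

theorem ofStdSphere_toStdSphere (v : PosFrame p Q₀) (x : unitSphere v.span) :
    ofStdSphere v (toStdSphere v x) = x.1 := by
  set c := WithLp.toLp 2 (frameCoord Q₀ v.1.1 x.1.1.2) with hc
  have hn : 0 < ‖c‖ := norm_pos_iff.2 (frameCoord_ne_zero x.2)
  have h1 : ∑ k, (toStdSphere v x).1 k • v.1.1 k = ‖c‖⁻¹ • x.1.1.2 := by
    conv_rhs => rw [← sum_frameCoord v x.2.2.1, Finset.smul_sum]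
    refine Finset.sum_congr rfl fun k _ => ?_
    rw [smul_smul]
    rfl
  refine Subtype.ext (Prod.ext x.2.1.symm ?_)
  change (√(Q₀ (∑ k, (toStdSphere v x).1 k • v.1.1 k)))⁻¹ •
    ∑ k, (toStdSphere v x).1 k • v.1.1 k = x.1.1.2
  rw [h1, QuadraticMap.map_smul, x.2.2.2, smul_eq_mul, mul_one,
    Real.sqrt_mul_self (inv_pos.2 hn).le, inv_inv, smul_smul, mul_inv_cancel₀ hn.ne', one_smul]

theorem toStdSphere_ofStdSphere (v : PosFrame p Q₀)
    (u : Metric.sphere (0 : EuclideanSpace ℝ (Fin p)) 1) :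
    toStdSphere v ⟨ofStdSphere v u, ofStdSphere_mem v u⟩ = u := by
  set n := √(Q₀ (∑ k, u.1 k • v.1.1 k)) with hn
  have hn0 : 0 < n := Real.sqrt_pos.2 (apply_frame_sum_pos v u)
  have hc : WithLp.toLp 2 (frameCoord Q₀ v.1.1 (ofStdSphere v u).1.2) = n⁻¹ • u.1 := by
    ext k
    change frameCoord Q₀ v.1.1 (n⁻¹ • ∑ k, u.1 k • v.1.1 k) k = n⁻¹ • u.1 k
    rw [map_smul, frameCoord_sum v.1.2 v.2]
    rfl
  refine Subtype.ext ?_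
  change ‖WithLp.toLp 2 (frameCoord Q₀ v.1.1 (ofStdSphere v u).1.2)‖⁻¹ •
    WithLp.toLp 2 (frameCoord Q₀ v.1.1 (ofStdSphere v u).1.2) = u.1
  rw [hc, norm_smul, norm_eq_of_mem_sphere u, mul_one, norm_inv, Real.norm_of_nonneg hn0.le,
    inv_inv, smul_smul, mul_inv_cancel₀ hn0.ne', one_smul]

end Sphere

/-- In the chart `U i`, the coordinates in a continuous frame give a trivialization. -/
theorem FlatAtlas.isFibreBundle_sphere [NeZero p] [TopologicalSpace V] [ContinuousAdd V]
    [ContinuousSMul ℝ V] [TopologicalSpace (Σ b : B, Gr p (E b) × E b)]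
    (hA : ∀ i, IsOpenEmbedding (A.grChart p i))
    (hQ : Continuous fun x : V × V => polar Q₀ x.1 x.2)
    (P : ∀ b, PosGr p (Q b)) (hP : ∀ i, ∃ v : A.U i → PosFrame p Q₀, Continuous v ∧
      ∀ b : A.U i, P b = (v b).span.map (A.equiv i b.2) (A.isometry i b.2)) :
    IsFibreBundle (Metric.sphere (0 : EuclideanSpace ℝ (Fin p)) 1)
      (fun x : SphereTotal P => x.1.1.1) := by
  have : Nonempty (Metric.sphere (0 : EuclideanSpace ℝ (Fin p)) 1) :=
    (NormedSpace.sphere_nonempty.2 zero_le_one).to_subtype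
  refine isFibreBundle_of_isOpenEmbedding fun b => ?_
  obtain ⟨i, hi⟩ := A.exists_mem b
  obtain ⟨v, hv, hPv⟩ := hP i
  let Z : Set (PeriodTotal p Q) := {x | x.fibre ∈ unitSphere (P x.1.1)}
  let c : A.periodChart p i ⁻¹' Z → Z := Z.restrictPreimage (A.periodChart p i)
  have hc : IsOpenEmbedding c := (A.isOpenEmbedding_periodChart (hA i)).restrictPreimage Z
  have hmem (y : A.U i × periodSpace p Q₀) :
      y ∈ A.periodChart p i ⁻¹' Z ↔ y.2 ∈ unitSphere (v y.1).span := by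
    change periodMap (A.equiv i y.1.2) (A.isometry i y.1.2) y.2 ∈ unitSphere (P y.1) ↔ _
    rw [hPv]
    exact periodMap_mem_unitSphere _ (A.isometry i y.1.2)
  have hvk (k : Fin p) : Continuous fun b => (v b).1.1 k :=
    (continuous_frame_apply k).comp (continuous_subtype_val.comp hv)
  let h : A.U i × Metric.sphere (0 : EuclideanSpace ℝ (Fin p)) 1 ≃ₜ A.periodChart p i ⁻¹' Z :=
    { toFun := fun y => ⟨(y.1, ofStdSphere (v y.1) y.2), (hmem _).2 (ofStdSphere_mem _ _)⟩
      invFun := fun y => (y.1.1, toStdSphere (v y.1.1) ⟨y.1.2, (hmem _).1 y.2⟩)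
      left_inv := fun y => Prod.ext rfl (toStdSphere_ofStdSphere _ _)
      right_inv := fun y => Subtype.ext (Prod.ext rfl (ofStdSphere_toStdSphere _ _))
      continuous_toFun := by
        have hsum : Continuous fun y : A.U i × Metric.sphere (0 : EuclideanSpace ℝ (Fin p)) 1 =>
            ∑ k, y.2.1 k • (v y.1).1.1 k := by
          refine continuous_finsetSum _ fun k _ => ?_
          exact Continuous.smul (by fun_prop) ((hvk k).comp continuous_fst)
        refine continuous_induced_rng.2 (continuous_fst.prodMk
          (continuous_induced_rng.2 (.prodMk ?_ (.smul ?_ hsum))))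
        · exact continuous_subtype_val.comp (PosFrame.isOpenQuotientMap_span.continuous.comp
            (hv.comp continuous_fst))
        · exact ((continuous_quadraticForm hQ).comp hsum).sqrt.inv₀ fun y =>
            (Real.sqrt_pos.2 (apply_frame_sum_pos (v y.1) y.2)).ne'
      continuous_invFun := by
        have hcoord : Continuous fun y : A.periodChart p i ⁻¹' Z =>
            WithLp.toLp 2 (frameCoord Q₀ (v y.1.1).1.1 y.1.2.1.2) :=
          (PiLp.continuous_toLp 2 _).comp (continuous_frameCoord hQ
            (hv.comp (continuous_fst.comp continuous_subtype_val)) (by fun_prop))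
        refine .prodMk (by fun_prop) (continuous_induced_rng.2 ?_)
        exact (hcoord.norm.inv₀ fun y =>
          norm_ne_zero_iff.2 (frameCoord_ne_zero ((hmem _).1 y.2))).smul hcoord }
  refine ⟨A.U i, A.isOpen_U i, hi, c ∘ h, hc.comp h.isOpenEmbedding, fun y => rfl, fun x hx => ?_⟩
  obtain ⟨y, hy⟩ := A.exists_periodChart_eq i x.1 hx
  have hyZ : (⟨x.1.1.1, hx⟩, y) ∈ A.periodChart p i ⁻¹' Z := by
    change A.periodChart p i _ ∈ Z
    rw [hy]
    exact x.2
  refine ⟨h.symm ⟨_, hyZ⟩, Subtype.ext ?_⟩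
  simpa [c] using hy

end FlatBundle

/-! ### The intersection form and the flat structure on `H²` of the fibres -/

section Naturality

variable {X Y : Type u} [TopologicalSpace X] [TopologicalSpace Y]

theorem cup_pull (f : C(X, Y)) (x y : Cohomology Y 2) :
    cup (Cohomology.pull f 2 x) (Cohomology.pull f 2 y) = Cohomology.pull f 4 (cup x y) := by
  obtain ⟨φ, rfl⟩ := Submodule.mkQ_surjective _ x
  obtain ⟨ψ, rfl⟩ := Submodule.mkQ_surjective _ y
  refine congrArg (Cohomology.mk X 4) (Subtype.ext ?_)
  funext σ
  change φ.1 _ * ψ.1 _ = φ.1 _ * ψ.1 _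
  rw [Simplex.push_sub, Simplex.push_sub]

theorem evalChain_push (f : C(X, Y)) (n : ℕ) (c : Chain X n) (φ : Cochain Y n) :
    evalChain n (Chain.push f n c) φ = evalChain n c (Cochain.pull f n φ) := by
  induction c using Finsupp.induction_linear with
  | zero => simp
  | add c d hc hd => simp [hc, hd]
  | single σ k =>
    simp [evalChain, Chain.push, Cochain.pull, Finsupp.mapDomain_single, LinearMap.funLeft_apply]

theorem kronecker_push (f : C(X, Y)) (n : ℕ) (z : Homology X n) (x : Cohomology Y n) :
    kronecker n (Homology.push f n z) x = kronecker n z (Cohomology.pull f n x) := by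
  obtain ⟨c, rfl⟩ := Submodule.mkQ_surjective _ z
  obtain ⟨φ, rfl⟩ := Submodule.mkQ_surjective _ x
  exact evalChain_push f n c.1 φ.1

theorem intersectionForm_push (f : C(X, Y)) (z : Homology X 4) (x : Cohomology Y 2) :
    intersectionForm (Homology.push f 4 z) x = intersectionForm z (Cohomology.pull f 2 x) := by
  change kronecker 4 (Homology.push f 4 z) (cup x x) = kronecker 4 z (cup _ _)
  rw [kronecker_push, cup_pull]

end Naturality

section PeriodBundle

open Topology

variable {M X : Type u} {B : Type v} [TopologicalSpace M] [TopologicalSpace X]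
  [TopologicalSpace B] {π : X → B}

/-- Over a path in the base, the transition maps between two trivializations are homotopic. -/
theorem transition_homotopic (e e' : Bundle.Trivialization M π) {b c : B}
    (h : JoinedIn (e.baseSet ∩ e'.baseSet) b c) (hb : b ∈ e.baseSet) (hb' : b ∈ e'.baseSet)
    (hc : c ∈ e.baseSet) (hc' : c ∈ e'.baseSet) :
    ((e.preimageSingletonHomeomorph hb : C(π ⁻¹' {b}, M)).comp
      ((e'.preimageSingletonHomeomorph hb').symm : C(M, π ⁻¹' {b}))).Homotopic
    ((e.preimageSingletonHomeomorph hc : C(π ⁻¹' {c}, M)).comp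
      ((e'.preimageSingletonHomeomorph hc').symm : C(M, π ⁻¹' {c}))) := by
  obtain ⟨γ, hγ⟩ := h
  have h1 : Continuous fun x : unitInterval × M =>
      e'.toOpenPartialHomeomorph.symm (γ x.1, x.2) := by
    refine e'.toOpenPartialHomeomorph.continuousOn_symm.comp_continuous (by fun_prop) fun x => ?_
    rw [e'.target_eq]
    exact ⟨(hγ x.1).2, Set.mem_univ _⟩
  have h2 (x : unitInterval × M) : e'.toOpenPartialHomeomorph.symm (γ x.1, x.2) ∈ e.source := by
    rw [e.mem_source, e'.proj_symm_apply' (hγ x.1).2]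
    exact (hγ x.1).1
  refine ⟨{ toFun := fun x => (e (e'.toOpenPartialHomeomorph.symm (γ x.1, x.2))).2
            continuous_toFun := continuous_snd.comp
              (e.toOpenPartialHomeomorph.continuousOn.comp_continuous h1 h2)
            map_zero_left := fun x => ?_
            map_one_left := fun x => ?_ }⟩
  · rw [γ.source]
    rfl
  · rw [γ.target]
    rfl

theorem eventually_pullEquiv_eq [LocallyPathConnectedSpace B] (e e' : Bundle.Trivialization M π)
    {b₀ : B} (h : b₀ ∈ e.baseSet) (h' : b₀ ∈ e'.baseSet) :
    ∀ᶠ b in 𝓝 b₀, ∀ (hb : b ∈ e.baseSet) (hb' : b ∈ e'.baseSet) (x : Cohomology M 2),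
      (Cohomology.pullEquiv (e'.preimageSingletonHomeomorph hb') 2).symm
          (Cohomology.pullEquiv (e.preimageSingletonHomeomorph hb) 2 x) =
        (Cohomology.pullEquiv (e'.preimageSingletonHomeomorph h') 2).symm
          (Cohomology.pullEquiv (e.preimageSingletonHomeomorph h) 2 x) := by
  have hopen : e.baseSet ∩ e'.baseSet ∈ 𝓝 b₀ :=
    (e.open_baseSet.inter e'.open_baseSet).mem_nhds ⟨h, h'⟩
  filter_upwards [pathComponentIn_mem_nhds hopen] with b hb hbe hbe' x
  have := Cohomology.pull_two_eq_of_homotopic (transition_homotopic e e' hb h h' hbe hbe')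
  have h1 := LinearMap.congr_fun this x
  rw [Cohomology.pull_comp, Cohomology.pull_comp] at h1
  exact h1.symm

theorem GrBundle.continuous_chart (p : ℕ) (e : Bundle.Trivialization M π) :
    Continuous (GrBundle.chart p e) :=
  continuous_iSup_rng (i := e) continuous_coinduced_rng

theorem GrBundle.chart_injective (p : ℕ) (e : Bundle.Trivialization M π) :
    Function.Injective (GrBundle.chart p e) := by
  rintro ⟨⟨b, hb⟩, W, l⟩ ⟨⟨b', hb'⟩, W', l'⟩ h
  obtain rfl : b = b' := congrArg Sigma.fst h
  have h1 := eq_of_heq (Sigma.mk.inj h).2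
  have hW : W = W' := Gr.map_injective _ (congrArg Prod.fst h1)
  have hl : l = l' := LinearEquiv.injective _ (congrArg Prod.snd h1)
  rw [hW, hl]

/-- The flat charts are open embeddings, because the transition maps are locally constant. -/
theorem GrBundle.isOpenEmbedding_chart [LocallyPathConnectedSpace B] (p : ℕ)
    (e : Bundle.Trivialization M π) : IsOpenEmbedding (GrBundle.chart p e) := by
  refine .of_continuous_injective_isOpenMap (GrBundle.continuous_chart p e)
    (GrBundle.chart_injective p e) fun O hO => ?_
  refine isOpen_iSup_iff.2 fun e' => isOpen_coinduced.2 (isOpen_iff_mem_nhds.2 ?_)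
  rintro ⟨⟨b, hb'⟩, W, l⟩ ⟨⟨⟨c, hb⟩, y⟩, hyO, hy⟩
  obtain rfl : c = b := congrArg Sigma.fst hy
  let g : Cohomology M 2 ≃ₗ[ℝ] Cohomology M 2 :=
    (Cohomology.pullEquiv (e'.preimageSingletonHomeomorph hb') 2).trans
      (Cohomology.pullEquiv (e.preimageSingletonHomeomorph hb) 2).symm
  have := IsModuleTopology.toContinuousAdd ℝ (Cohomology M 2)
  have hg : Continuous g := IsModuleTopology.continuous_of_linearMap g.toLinearMap
  have key {b : B} (h' : b ∈ e'.baseSet) (h : b ∈ e.baseSet)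
      (hgb : ∀ x, (Cohomology.pullEquiv (e.preimageSingletonHomeomorph h) 2).symm
        (Cohomology.pullEquiv (e'.preimageSingletonHomeomorph h') 2 x) = g x)
      (x : Gr p (Cohomology M 2) × Cohomology M 2) :
      GrBundle.chart p e (⟨b, h⟩, Gr.map g x.1, g x.2) = GrBundle.chart p e' (⟨b, h'⟩, x) := by
    have hgb' (z : Cohomology M 2) :
        Cohomology.pullEquiv (e.preimageSingletonHomeomorph h) 2 (g z) =
        Cohomology.pullEquiv (e'.preimageSingletonHomeomorph h') 2 z := by
      rw [← hgb, LinearEquiv.apply_symm_apply]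
    refine congrArg (Sigma.mk b) (Prod.ext (Subtype.ext ?_) (hgb' x.2))
    change (x.1.1.map g.toLinearMap).map _ = x.1.1.map _
    rw [← Submodule.map_comp]
    congr 1
    exact LinearMap.ext hgb'
  have hy' : y = (Gr.map g W, g l) := by
    have h1 := GrBundle.chart_injective p e (hy.trans (key hb' hb (fun _ => rfl) (W, l)).symm)
    exact congrArg Prod.snd h1
  obtain ⟨O', hO', rfl⟩ := (IsOpenEmbedding.prodMap e.open_baseSet.isOpenEmbedding_subtypeVal
    .id).isInducing.isOpen_iff.1 hO
  have hcont : Continuous fun x : e'.baseSet × (Gr p (Cohomology M 2) × Cohomology M 2) =>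
      ((x.1 : B), (Gr.map g x.2.1, g x.2.2)) :=
    (continuous_subtype_val.comp continuous_fst).prodMk
      (((Gr.continuous_map g hg).comp (continuous_fst.comp continuous_snd)).prodMk
        (hg.comp (continuous_snd.comp continuous_snd)))
  have hfst : Filter.Tendsto (fun x : e'.baseSet × (Gr p (Cohomology M 2) × Cohomology M 2) =>
      (x.1 : B)) (𝓝 (⟨c, hb'⟩, W, l)) (𝓝 c) :=
    (continuous_subtype_val.comp continuous_fst).continuousAt
  filter_upwards [hcont.continuousAt.preimage_mem_nhds (hO'.mem_nhds (by subst hy'; exact hyO)),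
    hfst.eventually (eventually_pullEquiv_eq e' e hb' hb),
    hfst.eventually (e.open_baseSet.mem_nhds hb)] with x hx1 hx2 hx3
  exact ⟨(⟨x.1, hx3⟩, Gr.map g x.2.1, g x.2.2), hx1, key x.1.2 hx3 (hx2 x.1.2 hx3) x.2⟩

/-- The flat atlas on the second cohomology of the fibres, given by the trivializations that
preserve the orientations of the fibres. -/
noncomputable def periodAtlas [LocallyPathConnectedSpace B] {μ : Homology M 4}
    {o : ∀ b : B, Homology (π ⁻¹' {b}) 4} (hπ : IsOrientedFibreBundle M π μ o) :
    FlatAtlas {e : Bundle.Trivialization M π // ∀ (b : B) (hb : b ∈ e.baseSet),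
      Homology.push (e.preimageSingletonHomeomorph hb : C(π ⁻¹' {b}, M)) 4 (o b) = μ}
      (intersectionForm μ) (fun b => intersectionForm (o b)) where
  U e := e.1.baseSet
  isOpen_U e := e.1.open_baseSet
  exists_mem b :=
    let ⟨e, hb, he⟩ := hπ b
    ⟨⟨e, he⟩, hb⟩
  equiv e _ hb := Cohomology.pullEquiv (e.1.preimageSingletonHomeomorph hb) 2
  isometry e b hb x := (intersectionForm_push _ _ _).symm.trans
    (congrArg (fun z => intersectionForm z x) (e.2 b hb))
  eventually_eq e e' _ h h' := eventually_pullEquiv_eq e.1 e'.1 h h'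

end PeriodBundle

/-- The sphere bundle exists for every flat bundle of finite dimensional quadratic spaces: finite
dimensionality makes the form jointly continuous and gives a positive definite `p`-plane. -/
theorem FlatAtlas.exists_sphereBundle {B : Type v} [TopologicalSpace B] [CompactSpace B] [T2Space B]
    {V : Type u} [AddCommGroup V] [Module ℝ V] [TopologicalSpace V] [IsModuleTopology ℝ V]
    [Module.Finite ℝ V] {ι : Type*} {Q₀ : QuadraticForm ℝ V} {E : B → Type u}
    [∀ b, AddCommGroup (E b)] [∀ b, Module ℝ (E b)] {Q : ∀ b, QuadraticForm ℝ (E b)}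
    (A : FlatAtlas ι Q₀ Q) {p : ℕ} (hp : p = sigPos Q₀) [NeZero p]
    [t : TopologicalSpace (Σ b : B, Gr p (E b) × E b)]
    (hA : ∀ i, Topology.IsOpenEmbedding (A.grChart p i)) :
    ∃ (S : Type (max u v)) (_ : TopologicalSpace S) (s : S → B),
      IsFibreBundle (Metric.sphere (0 : EuclideanSpace ℝ (Fin p)) 1) s ∧
        FibrewiseHomotopyEquivalent (fun x : PeriodTotal p Q => x.1.1) s := by
  have := IsModuleTopology.topologicalAddGroup ℝ V
  have hQ : Continuous fun x : V × V => QuadraticMap.polar Q₀ x.1 x.2 :=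
    IsModuleTopology.continuous_bilinear_of_finite_left Q₀.polarBilin
  have hle : PosIndexLE p Q₀ := hp ▸ posIndexLE_sigPos
  obtain ⟨W, hW, hpos⟩ := exists_finrank_eq_sigPos_and_posDef Q₀
  obtain ⟨P, hP⟩ := A.exists_posPlane hle ⟨⟨W, inferInstance, hW.trans hp.symm⟩, hpos⟩
  exact ⟨SphereTotal P, inferInstance, _, A.isFibreBundle_sphere hA hQ P hP,
    A.fibrewiseHomotopyEquivalent hA hle hQ P hP⟩

theorem notMem_periodSpace_zero {V : Type u} [AddCommGroup V] [Module ℝ V]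
    (Q : QuadraticForm ℝ V) (x : Gr 0 V × V) : x ∉ periodSpace 0 Q := by
  intro hx
  have := x.1.2.1
  have h : x.1.1 = ⊥ := Submodule.finrank_eq_zero.1 x.1.2.2
  refine (mem_periodSpace_iff.1 hx).2 ?_
  have := posProj_mem (Q := Q) x.1 x.2
  rwa [h, Submodule.mem_bot] at this

theorem isFibreBundle_of_isEmpty {F E B : Type*} [TopologicalSpace F] [TopologicalSpace E]
    [TopologicalSpace B] [IsEmpty F] [IsEmpty E] (s : E → B) : IsFibreBundle F s := fun _ =>
  ⟨{ toOpenPartialHomeomorph :=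
      (Homeomorph.empty : E ≃ₜ B × F).toOpenPartialHomeomorph
     baseSet := Set.univ
     open_baseSet := isOpen_univ
     source_eq := rfl
     target_eq := by simp
     proj_toFun := fun x => isEmptyElim x }, Set.mem_univ _⟩

theorem FibrewiseHomotopyEquivalent.refl {E B : Type*} [TopologicalSpace E] (s : E → B) :
    FibrewiseHomotopyEquivalent s s :=
  ⟨.id E, .id E, fun _ => rfl, fun _ => rfl, .refl _ fun _ => rfl, .refl _ fun _ => rfl⟩

end FamilySW

theorem proposition3p5 {M X : Type u} {B : Type v}
    [TopologicalSpace M] [TopologicalSpace X] [TopologicalSpace B]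
    [T2Space M] [CompactSpace M] [ChartedSpace (EuclideanSpace ℝ (Fin 4)) M]
    {m : ℕ} [T2Space B] [CompactSpace B] [ChartedSpace (EuclideanSpace ℝ (Fin m)) B]
    (μ : FamilySW.Homology M 4) (hμ : FamilySW.IsFundamentalClass μ)
    (π : X → B) (o : ∀ b : B, FamilySW.Homology (π ⁻¹' {b}) 4)
    (hπ : FamilySW.IsOrientedFibreBundle M π μ o)
    (p : ℕ) (hp : p = sigPos (FamilySW.intersectionForm μ)) :
    ∃ (S : Type (max u v)) (_ : TopologicalSpace S) (s : S → B),
      FamilySW.IsFibreBundle (Metric.sphere (0 : EuclideanSpace ℝ (Fin p)) 1) s ∧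
        FamilySW.FibrewiseHomotopyEquivalent (FamilySW.PeriodBundle.proj M π p o) s := by
  -- For `p = 0` the period bundle has empty fibres, as has the bundle of `(-1)`-spheres.
  obtain rfl | hp0 := Nat.eq_zero_or_pos p
  · have : IsEmpty (FamilySW.PeriodBundle M π 0 o) :=
      ⟨fun x => FamilySW.notMem_periodSpace_zero _ _ x.2⟩
    have : IsEmpty (Metric.sphere (0 : EuclideanSpace ℝ (Fin 0)) 1) := by
      refine ⟨fun x => ?_⟩
      have h := norm_eq_of_mem_sphere x
      rw [Subsingleton.elim x.1 0, norm_zero] at h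
      exact zero_ne_one h
    exact ⟨FamilySW.PeriodBundle M π 0 o, inferInstance, FamilySW.PeriodBundle.proj M π 0 o,
      FamilySW.isFibreBundle_of_isEmpty _, .refl _⟩
  · -- `p` is at most the `finrank` of `H²(M; ℝ)`, which would be `0` in infinite dimension.
    have : NeZero p := ⟨hp0.ne'⟩
    have : Module.Finite ℝ (FamilySW.Cohomology M 2) :=
      Module.finite_of_finrank_pos (hp0.trans_le (hp ▸ sigPos_le_finrank _))
    have : LocallyPathConnectedSpace B :=
      ChartedSpace.locallyPathConnectedSpace (EuclideanSpace ℝ (Fin m)) B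
    let A := FamilySW.periodAtlas hπ
    exact A.exists_sphereBundle (t := (inferInstance : TopologicalSpace (FamilySW.GrBundle M π p)))
      hp fun e => FamilySW.GrBundle.isOpenEmbedding_chart p e.1
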